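/- The following is a theorem of ZF (that is, it holds in every model of ZF). Conventions. For an ordinal $\gamma$: $\mathrm{AC}_\gamma$ says that every family $\langle X_a : a<\gamma\rangle$ of nonempty sets has a choice function; $\mathrm{DC}_\gamma$ says that for every set $X$, every tree $T\subseteq {}^{<\gamma}X$ (a set of functions from ordinals less than $\gamma$ to $X$, closed under restriction to smaller ordinals) has a maximal branch, i.e. a pairwise compatible subset of $T$ that is not properly contained in another one. For a set $x$ of ordinals, $\mathrm{o.t.}(x)$ is its ordertype and, for $\eta<\mathrm{o.t.}(x)$, $x(\eta)$ is the unique $\alpha\in x$ with $\mathrm{o.t.}(x\cap\alpha)=\eta$. For a sequence $\bar C=\langle c_\delta:\delta\in S\rangle$ of sets of ordinals and ordinals $\eta,\alpha,\beta$, let $$S^{\eta}_{\alpha,\beta}(\bar C)=\{\delta\in S : \mathrm{o.t.}(c_\delta)>\eta \text{ and } c_\delta(\eta)\in[\alpha,\beta)\},$$ and let $\bar C\restriction\xi=\langle c_\delta : \delta\in S\cap\xi\rangle$. A subset of an ordinal $\xi$ is stationary in $\xi$ if it meets every closed unbounded subset of $\xi$. Theorem. Suppose that: - $\theta\ge\aleph_0$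 is a regular cardinal such that $\mathrm{DC}_\theta$ holds; - $\gamma\ge\theta$ is an ordinal such that $\mathrm{AC}_\gamma$ holds; - $\lambda$ is an ordinal with $\mathrm{cf}(\lambda)>\gamma$; - $E$ is a closed unbounded subset of $\lambda$; - $\bar C=\langle c_\delta : \delta\in E,\ \mathrm{cf}(\delta)=\theta\rangle$ is a sequence such that each $c_\delta$ is a cofinal subset of $\delta$ of ordertype at most $\gamma$. Then: 1. There is an $\eta^*<\gamma$ such that for each $\alpha<\lambda$ there is a $\beta\in(\alpha,\lambda)$ such that $S^{\eta^*}_{\alpha,\beta}(\bar C)$ is a stationary subset of $\lambda$. 2. Let $C$ be the set of $\xi<\lambda$ such that $\gamma<\mathrm{cf}(\xi)<\lambda$ and $E\cap\xi$ is unbounded in $\xi$. There are functions $g\colon C\to\gamma$ and $h\colon C\to\lambda$ and a family of ordinals $\langle\alpha^\xi_\beta : \xi\in C,\ \beta<h(\xi)\rangle$ such that for each $\xi\in C$: - $h(\xi)<\mathrm{cf}(\xi)^+$, the least cardinal greater than $\mathrm{cf}(\xi)$; - $\langle\alpha^\xi_\beta : \beta<h(\xi)\rangle$ is a continuous, strictly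 increasing sequence of elements of $\xi$, cofinal in $\xi$; - for each $\beta<h(\xi)$, also $\beta+1<h(\xi)$, and $S^{g(\xi)}_{\alpha^\xi_\beta,\alpha^\xi_{\beta+1}}(\bar C\restriction\xi)$ is a stationary subset of $\xi$. -/

import Mathlib

/-! Theorems of ZF are rendered as statements about an arbitrary model `M` of ZF, a first-order
structure for the language with one binary relation symbol. Below, "set" means an element of `M`;
every quantifier in a set-theoretic notion ranges over elements of `M`, so functions, club sets,
branches, order isomorphisms, ... are always elements of `M`. A `Set M` occurs only as a class,
i.e. as the extension of a formula (with parameters) of the language of set theory. -/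

namespace ZFM

/-- The only symbol of the language of set theory: the binary relation of membership. -/
inductive SetRel : ℕ → Type
  | mem : SetRel 2

/-- The first-order language of set theory. -/
def setLang : FirstOrder.Language := ⟨fun _ => Empty, SetRel⟩

variable {M : Type*} [setLang.Structure M]

/-- The membership relation of the structure `M`. -/
def Mem (x y : M) : Prop :=
  FirstOrder.Language.Structure.RelMap (L := setLang) (M := M) SetRel.mem ![x, y]

infix:50 " ∊ " => Mem

/-- `x ⊆ y` in `M`. -/
def Sub (x y : M) : Prop := ∀ z : M, z ∊ x → z ∊ y

/-- `x ≤ y` for ordinals: `x ∈ y` or `x = y`. -/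
def Le (x y : M) : Prop := x ∊ y ∨ x = y

/-- The class of all elements of a set. -/
def ext (a : M) : Set M := {x | x ∊ a}

/-- `s = x ∪ {x}`. -/
def IsSucc (x s : M) : Prop := ∀ z : M, z ∊ s ↔ z ∊ x ∨ z = x

/-- `M` is a model of first-order ZF. The separation and replacement schemes are stated for all
relations that are definable over `(M, ∊)` by a first-order formula with parameters from `M`. -/
structure ModelsZF (M : Type*) [setLang.Structure M] : Prop where
  extensionality : ∀ x y : M, (∀ z : M, z ∊ x ↔ z ∊ y) → x = y
  foundation : ∀ a : M, (∃ x : M, x ∊ a) → ∃ x : M, x ∊ a ∧ ∀ y : M, y ∊ x → ¬ y ∊ a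
  pairing : ∀ x y : M, ∃ a : M, ∀ z : M, z ∊ a ↔ z = x ∨ z = y
  union : ∀ a : M, ∃ u : M, ∀ z : M, z ∊ u ↔ ∃ y : M, y ∊ a ∧ z ∊ y
  power : ∀ a : M, ∃ p : M, ∀ z : M, z ∊ p ↔ Sub z a
  infinity : ∃ w : M, (∃ e : M, e ∊ w ∧ ∀ z : M, ¬ z ∊ e) ∧
    ∀ x : M, x ∊ w → ∃ s : M, s ∊ w ∧ IsSucc x s
  separation : ∀ P : Set M, (Set.univ : Set M).Definable₁ setLang P →
    ∀ a : M, ∃ b : M, ∀ z : M, z ∊ b ↔ z ∊ a ∧ z ∈ P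
  replacement : ∀ R : Set (M × M), (Set.univ : Set M).Definable₂ setLang R →
    ∀ a : M, (∀ x : M, x ∊ a → ∃! y : M, (x, y) ∈ R) →
      ∃ b : M, ∀ y : M, y ∊ b ↔ ∃ x : M, x ∊ a ∧ (x, y) ∈ R

/-! ### Ordered pairs and functions -/

/-- `p` is the Kuratowski pair `{{x}, {x, y}}`. -/
def IsPair (p x y : M) : Prop :=
  ∀ z : M, z ∊ p ↔ (∀ w : M, w ∊ z ↔ w = x) ∨ (∀ w : M, w ∊ z ↔ w = x ∨ w = y)

/-- `(x, y) ∈ f`; for a function `f`, this says `f(x) = y`. -/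
def App (f x y : M) : Prop := ∃ p : M, p ∊ f ∧ IsPair p x y

/-- `f` is a function with domain `A`. -/
def FunOn (f : M) (A : Set M) : Prop :=
  (∀ p : M, p ∊ f → ∃ x y : M, IsPair p x y ∧ x ∈ A) ∧ ∀ x ∈ A, ∃! y : M, App f x y

/-- `f` is a function from `A` to `B`. -/
def FunTo (f : M) (A B : Set M) : Prop :=
  FunOn f A ∧ ∀ x y : M, App f x y → y ∈ B

/-- `f` is a bijection from `A` to `B`. -/
def Bij (f : M) (A B : Set M) : Prop :=
  FunTo f A B ∧ (∀ y ∈ B, ∃ x : M, App f x y) ∧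
    ∀ x x' y : M, App f x y → App f x' y → x = x'

/-- `r` is the restriction of the function `f` to the set `a`. -/
def IsRestriction (f a r : M) : Prop :=
  ∀ p : M, p ∊ r ↔ p ∊ f ∧ ∃ x y : M, IsPair p x y ∧ x ∊ a

/-! ### Ordinals, order types, cofinalities, cardinals -/

/-- `a` is a transitive set. -/
def IsTrans (a : M) : Prop := ∀ x : M, x ∊ a → Sub x a

/-- `a` is an ordinal: a transitive set of transitive sets. -/
def IsOrd (a : M) : Prop := IsTrans a ∧ ∀ x : M, x ∊ a → IsTrans x

/-- `a` is a nonzero limit ordinal. -/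
def IsLimit (a : M) : Prop :=
  IsOrd a ∧ (∃ x : M, x ∊ a) ∧ ∀ x : M, x ∊ a → ∃ y : M, y ∊ a ∧ x ∊ y

/-- `A` is a cofinal subset of the ordinal `d`. -/
def Cofinal (A : Set M) (d : M) : Prop :=
  A ⊆ ext d ∧ ∀ x : M, x ∊ d → ∃ y ∈ A, Le x y

/-- The class `A` of ordinals has order type `r`. -/
def OrderType (A : Set M) (r : M) : Prop :=
  IsOrd r ∧ ∃ f : M, Bij f A (ext r) ∧
    ∀ x y i j : M, App f x i → App f y j → x ∊ y → i ∊ j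

/-- `a` is the `i`-th member of the set of ordinals `x`: `a ∈ x` and `x ∩ a` has
order type `i`. -/
def IsNth (x i a : M) : Prop := a ∊ x ∧ OrderType (ext x ∩ ext a) i

/-- The function `f : k → d` has range cofinal in `d`. -/
def CofinalMap (f k d : M) : Prop :=
  FunTo f (ext k) (ext d) ∧ Cofinal {y | ∃ i : M, App f i y} d

/-- `k` is the cofinality of the ordinal `d`: the least ordinal that has a map into `d` with
cofinal range. -/
def IsCof (d k : M) : Prop :=
  IsOrd d ∧ IsOrd k ∧ (∃ f : M, CofinalMap f k d) ∧
    ∀ m : M, m ∊ k → ¬ ∃ f : M, CofinalMap f m d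

/-- `k` is an infinite regular cardinal: a nonzero limit ordinal that is its own cofinality. -/
def IsInfRegular (k : M) : Prop := IsLimit k ∧ IsCof k k

/-- `k` is a cardinal: an ordinal not equinumerous with any smaller ordinal. -/
def IsCardinal (k : M) : Prop :=
  IsOrd k ∧ ∀ m : M, m ∊ k → ¬ ∃ f : M, Bij f (ext m) (ext k)

/-- `m` is the least cardinal greater than `k`. -/
def IsCardSucc (k m : M) : Prop :=
  IsCardinal m ∧ k ∊ m ∧ ∀ n : M, IsCardinal n → k ∊ n → Le m n

/-! ### Club and stationary sets -/

/-- `D` is a closed unbounded subset of `l`. -/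
def Club (D l : M) : Prop :=
  Cofinal (ext D) l ∧
    ∀ d : M, d ∊ l → IsLimit d → Cofinal (ext D ∩ ext d) d → d ∊ D

/-- `S` is a stationary subset of `l`. -/
def Stationary (S : Set M) (l : M) : Prop :=
  S ⊆ ext l ∧ ∀ D : M, Club D l → ∃ d : M, d ∊ D ∧ d ∈ S

/-! ### Fragments of choice -/

/-- Choice for families indexed by `Z`. -/
def AC (Z : M) : Prop :=
  ∀ F : M, FunOn F (ext Z) → (∀ a X : M, App F a X → ∃ y : M, y ∊ X) →
    ∃ f : M, FunOn f (ext Z) ∧ ∀ a X y : M, App F a X → App f a y → y ∊ X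

/-- `T` is a tree of functions from ordinals smaller than `k` to `X`, closed under
restriction to ordinals. -/
def IsTree (T k X : M) : Prop :=
  ∀ f : M, f ∊ T → ∃ d : M, d ∊ k ∧ FunTo f (ext d) (ext X) ∧
    ∀ a : M, a ∊ d → ∃ r : M, r ∊ T ∧ IsRestriction f a r

/-- `b` is a branch of `T`: a set of pairwise compatible elements of `T`. -/
def IsBranch (b T : M) : Prop :=
  Sub b T ∧ ∀ f g : M, f ∊ b → g ∊ b → Sub f g ∨ Sub g f

/-- `b` is a branch of `T` that is not properly contained in another branch. -/
def IsMaxBranch (b T : M) : Prop :=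
  IsBranch b T ∧ ∀ b' : M, IsBranch b' T → Sub b b' → b' = b

/-- Dependent choice of length `k`: every tree of functions from ordinals smaller than `k` to
some set has a maximal branch. -/
def DC (k : M) : Prop :=
  ∀ X T : M, IsTree T k X → ∃ b : M, IsMaxBranch b T

/-! ### Ladder systems -/

/-- The class of ordinals `d ∈ E` with `d < l` and cofinality `t`. -/
def LadderDomain (l t E : M) : Set M := {d | d ∊ l ∧ IsCof d t ∧ d ∊ E}

/-- `c` is a sequence `⟨c_d⟩`, indexed by the members `d` of `E` below `l` of cofinality `t`, of
cofinal subsets `c_d` of `d` of order type at most `gam`. -/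
def IsLadderSystem (c l t gam E : M) : Prop :=
  FunOn c (LadderDomain l t E) ∧
    ∀ d x : M, App c d x → Cofinal (ext x) d ∧ ∃ r : M, OrderType (ext x) r ∧ Le r gam

/-- The restriction of a sequence (given by its graph) to indices in `xi`. -/
def restrictTo (R : M → M → Prop) (xi : M) : M → M → Prop := fun d x => R d x ∧ d ∊ xi

/-- For a sequence of sets of ordinals `⟨c_d⟩` with graph `R`, the class of those indices `d`
for which `c_d` has order type greater than `n` and the `n`-th member of `c_d` is in `[a, b)`. -/
def LadderS (R : M → M → Prop) (n a b : M) : Set M :=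
  {d | ∃ x : M, R d x ∧ (∃ r : M, OrderType (ext x) r ∧ n ∊ r) ∧
    ∃ e : M, IsNth x n e ∧ Le a e ∧ e ∊ b}

/-- The class of `xi < l` whose cofinality lies in `(gam, l)` and which are limit points of
`E`. -/
def HighCofPoints (l gam E : M) : Set M :=
  {xi | xi ∊ l ∧ (∃ k : M, IsCof xi k ∧ gam ∊ k ∧ k ∊ l) ∧ Cofinal (ext E ∩ ext xi) xi}

/-- `s` is a continuous, strictly increasing sequence of length `h`, cofinal in `xi`. -/
def ContIncCofinal (s h xi : M) : Prop :=
  FunTo s (ext h) (ext xi) ∧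
  (∀ i j a b : M, App s i a → App s j b → i ∊ j → a ∊ b) ∧
  (∀ i a : M, IsLimit i → App s i a →
    ∀ x : M, x ∊ a ↔ ∃ j b : M, j ∊ i ∧ App s j b ∧ x ∊ b) ∧
  Cofinal {a | ∃ i : M, App s i a} xi

end ZFM

/-! Part 1 is a proof by contradiction. If every index `n < γ` fails, let `a_n` be the least ordinal
at which it fails. Since cf(λ) > γ, a single α < λ bounds all the `a_n`, so no set S^n_{α,β} with n
< γ and α < β < λ is stationary. For one fixed β, AC_γ picks clubs avoiding these sets, and their
intersection is a club avoiding all of them at once. Picking such clubs for all β together would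
need too much choice. Instead, DC_θ builds a decreasing θ-sequence of clubs inside E and above α,
with strictly increasing minima, each club avoiding the sets S^n_{α,μ} for every earlier minimum μ.
The supremum δ of the minima has cofinality θ and lies in all the clubs, hence in E. Some member of
c_δ is at least α and lies below the minimum μ of the i-th club. It is the n-th member for some n <
γ, so δ is in S^n_{α,μ}, although δ belongs to the next club. This is `exists_statIn`.

Part 2 applies the same lemma to each ξ with the club E ∩ ξ. No choice is needed to combine the
results: g(ξ) is the least good index, and each next endpoint is the least one giving a stationary
set. The sequence stops on reaching ξ. Its length injects into cf(ξ), because ξ has a club indexed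
by cf(ξ), and the pairwise disjoint stationary sets each meet it (`exists_isInj_statLen`). A Hartogs
argument then puts the length below cf(ξ)⁺.

Separation and replacement are available only for first-order definable relations. The classes `Df`
and `DfF` let instance search supply definability, and every function used must be built from
definable operations such as `the`, `cl`, `leastOrd` and `iter`. -/

namespace ZFM

set_option linter.unusedSectionVars false
set_option linter.unusedVariables false

/-! ### Definable predicates and functions -/

section Definability

variable {M : Type*} [setLang.Structure M]

open FirstOrder FirstOrder.Language

/-- A predicate on valuations `ℕ → M` is definable if it is given by a first-order formula with
parameters from `M`. -/
class Df (P : (ℕ → M) → Prop) : Prop where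
  out : ∃ φ : (setLang[[(Set.univ : Set M)]]).Formula ℕ, ∀ v, φ.Realize v ↔ P v

/-- A function of valuations is definable if its graph is. -/
class DfF (f : (ℕ → M) → M) : Prop where
  out : Df fun v : ℕ → M => v 0 = f fun n => v (n + 1)

/-- The term denoting the parameter `a`. -/
def constTerm (a : M) : (setLang[[(Set.univ : Set M)]]).Term ℕ :=
  (setLang.con (⟨a, trivial⟩ : (Set.univ : Set M))).term

theorem realize_constTerm (a : M) (v : ℕ → M) : (constTerm a).realize v = a := by
  simp [constTerm]

theorem Df.congr {P Q : (ℕ → M) → Prop} (h : Df P) (e : ∀ v, Q v ↔ P v) : Df Q := by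
  obtain ⟨φ, hφ⟩ := h.out
  exact ⟨φ, fun v => (hφ v).trans (e v).symm⟩

theorem Df.subst {P : (ℕ → M) → Prop} (h : Df P)
    (tf : ℕ → (setLang[[(Set.univ : Set M)]]).Term ℕ) :
    Df fun v : ℕ → M => P fun n => (tf n).realize v := by
  obtain ⟨φ, hφ⟩ := h.out
  refine ⟨BoundedFormula.subst φ tf, fun v => ?_⟩
  rw [← hφ]
  exact BoundedFormula.realize_subst

theorem Df.rename {P : (ℕ → M) → Prop} (h : Df P) (ρ : ℕ → ℕ) :
    Df fun v : ℕ → M => P fun n => v (ρ n) := by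
  simpa using h.subst fun n => Term.var (ρ n)

theorem Df.all {P : (ℕ → M) → M → Prop}
    (h : Df fun w : ℕ → M => P (fun n => w (n + 1)) (w 0)) :
    Df fun v : ℕ → M => ∀ x, P v x := by
  obtain ⟨φ, hφ⟩ := h.out
  -- Variable 0 becomes the bound variable; variable `n + 1` becomes the free variable `n`.
  let g : ℕ → ℕ ⊕ Fin 1 := fun n => Nat.casesOn n (Sum.inr 0) Sum.inl
  refine ⟨(BoundedFormula.relabel g φ).all, fun v => ?_⟩
  rw [Formula.Realize, BoundedFormula.realize_all]
  refine forall_congr' fun a => ?_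
  rw [BoundedFormula.realize_relabel]
  have := hφ fun n => Nat.casesOn n a v
  rw [Formula.Realize] at this
  refine Iff.trans (iff_of_eq ?_) this
  congr 1
  · funext n
    cases n <;> rfl
  · exact Subsingleton.elim _ _

theorem Df.not' {P : (ℕ → M) → Prop} (h : Df P) : Df fun v => ¬ P v := by
  obtain ⟨φ, hφ⟩ := h.out
  exact ⟨φ.not, fun v => by rw [Formula.realize_not, hφ]⟩

theorem Df.and' {P Q : (ℕ → M) → Prop} (h : Df P) (h' : Df Q) : Df fun v => P v ∧ Q v := by
  obtain ⟨φ, hφ⟩ := h.out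
  obtain ⟨ψ, hψ⟩ := h'.out
  exact ⟨φ ⊓ ψ, fun v => by rw [Formula.realize_inf, hφ, hψ]⟩

theorem df_mem : Df fun v : ℕ → M => v 0 ∊ v 1 := by
  let R : (setLang[[(Set.univ : Set M)]]).Relations 2 := Sum.inl SetRel.mem
  refine ⟨R.formula₂ (Term.var 0) (Term.var 1), fun v => ?_⟩
  rw [Formula.realize_rel₂]
  rfl

theorem df_eq : Df fun v : ℕ → M => v 0 = v 1 :=
  ⟨(Term.var 0).equal (Term.var 1), fun v => by simp [Formula.realize_equal]⟩

/-- Higher-order unification lets the composition instances match almost anything, so variables and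
parameters have high priority and compositions low. -/
instance (priority := 2000) (n : ℕ) : DfF fun v : ℕ → M => v n where
  out := by
    refine (df_eq.rename fun k => Nat.casesOn k 0 fun _ => n + 1).congr fun v => ?_
    simp

instance (priority := 2000) (a : M) : DfF fun _ : ℕ → M => a where
  out := by
    refine ((df_eq (M := M)).subst fun k =>
      Nat.casesOn k (Term.var 0) fun _ => constTerm a).congr fun v => ?_
    simp [realize_constTerm]

instance {P : (ℕ → M) → M → Prop} [h : Df fun w : ℕ → M => P (fun n => w (n + 1)) (w 0)] :
    Df fun v : ℕ → M => ∀ x, P v x := h.all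

instance {P : (ℕ → M) → Prop} [h : Df P] : Df fun v => ¬ P v := h.not'

instance {P Q : (ℕ → M) → Prop} [h : Df P] [h' : Df Q] : Df fun v => P v ∧ Q v := h.and' h'

instance {P Q : (ℕ → M) → Prop} [h : Df P] [h' : Df Q] : Df fun v => P v ∨ Q v :=
  (h.not'.and' h'.not').not'.congr fun v => by tauto

instance {P Q : (ℕ → M) → Prop} [h : Df P] [h' : Df Q] : Df fun v => P v → Q v :=
  (h.and' h'.not').not'.congr fun v => by tauto

instance {P Q : (ℕ → M) → Prop} [h : Df P] [h' : Df Q] : Df fun v => P v ↔ Q v :=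
  ((h.and' h'.not').not'.and' (h'.and' h.not').not').congr fun v => by tauto

instance {P : (ℕ → M) → M → Prop} [h : Df fun w : ℕ → M => P (fun n => w (n + 1)) (w 0)] :
    Df fun v : ℕ → M => ∃ x, P v x :=
  (Df.all (P := fun v x => ¬ P v x) h.not').not'.congr fun v => by simp

/-- Substitution of a definable function into a definable predicate. -/
theorem Df.comp {P : (ℕ → M) → M → Prop} {s : (ℕ → M) → M}
    (h : Df fun w : ℕ → M => P (fun n => w (n + 1)) (w 0)) (hs : DfF s) :
    Df fun v : ℕ → M => P v (s v) := by
  have := Df.all (P := fun v x => ¬ (x = s v ∧ P v x)) (hs.out.and' h).not'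
  exact this.not'.congr fun v => by simp

instance (priority := 500) {P : M → Prop} {s : (ℕ → M) → M} [h : Df fun v : ℕ → M => P (v 0)]
    [hs : DfF s] : Df fun v => P (s v) :=
  Df.comp (P := fun _ x => P x) h hs

theorem DfF.lift {s : (ℕ → M) → M} (hs : DfF s) : DfF fun v : ℕ → M => s fun n => v (n + 1) where
  out := by
    refine (hs.out.rename fun k => Nat.casesOn k 0 fun n => n + 2).congr fun v => ?_
    simp

/-- Variable 1 is skipped: in the bodies of `img` and `graph` it is taken by a second bound
variable. -/
theorem DfF.lift_second {F : (ℕ → M) → M → M}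
    (h : DfF fun w : ℕ → M => F (fun n => w (n + 1)) (w 0)) :
    DfF fun w : ℕ → M => F (fun n => w (n + 2)) (w 0) where
  out := (h.out.rename fun k => Nat.casesOn k 0 fun k => Nat.casesOn k 1 fun n => n + 3).congr
    fun _ => Iff.rfl

instance (priority := 500) Df.comp₂ {P : M → M → Prop} {s t : (ℕ → M) → M}
    [h : Df fun v : ℕ → M => P (v 0) (v 1)]
    [hs : DfF s] [ht : DfF t] : Df fun v => P (s v) (t v) := by
  refine Df.comp (P := fun v x => P x (t v)) ?_ hs
  refine Df.comp (P := fun v x => P (v 0) x) ?_ ht.lift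
  exact (h.rename fun k => Nat.casesOn k 1 fun _ => 0).congr fun v => Iff.rfl

instance (priority := 500) Df.comp₃ {P : M → M → M → Prop} {s t u : (ℕ → M) → M}
    [h : Df fun v : ℕ → M => P (v 0) (v 1) (v 2)]
    [hs : DfF s] [ht : DfF t] [hu : DfF u] : Df fun v => P (s v) (t v) (u v) := by
  refine Df.comp (P := fun v x => P x (t v) (u v)) ?_ hs
  refine Df.comp (P := fun v x => P (v 0) x (u fun n => v (n + 1))) ?_ ht.lift
  refine Df.comp (P := fun v x => P (v 1) (v 0) x) ?_ hu.lift.lift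
  exact (h.rename fun k => Nat.casesOn k 2 fun k => Nat.casesOn k 1 fun _ => 0).congr
    fun v => Iff.rfl

instance (priority := 500) Df.comp₄ {P : M → M → M → M → Prop} {s t u r : (ℕ → M) → M}
    [h : Df fun v : ℕ → M => P (v 0) (v 1) (v 2) (v 3)]
    [hs : DfF s] [ht : DfF t] [hu : DfF u] [hr : DfF r] :
    Df fun v => P (s v) (t v) (u v) (r v) := by
  refine Df.comp (P := fun v x => P x (t v) (u v) (r v)) ?_ hs
  refine Df.comp (P := fun v x => P (v 0) x (u fun n => v (n + 1)) (r fun n => v (n + 1))) ?_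
    ht.lift
  refine Df.comp (P := fun v x => P (v 1) (v 0) x (r fun n => v (n + 2))) ?_ hu.lift.lift
  refine Df.comp (P := fun v x => P (v 2) (v 1) (v 0) x) ?_ hr.lift.lift.lift
  exact (h.rename fun k => Nat.casesOn k 3 fun k => Nat.casesOn k 2 fun k =>
    Nat.casesOn k 1 fun _ => 0).congr fun v => Iff.rfl

instance : Df fun v : ℕ → M => v 0 ∊ v 1 := df_mem
instance : Df fun v : ℕ → M => v 0 = v 1 := df_eq

instance (priority := 500) {F : M → M} {s : (ℕ → M) → M} [h : DfF fun v : ℕ → M => F (v 0)]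
    [hs : DfF s] : DfF fun v => F (s v) where
  out := by
    have := hs.lift
    exact Df.comp₂ (P := fun y x => y = F x) (h := h.out)

instance (priority := 500) {F : M → M → M} {s t : (ℕ → M) → M}
    [h : DfF fun v : ℕ → M => F (v 0) (v 1)]
    [hs : DfF s] [ht : DfF t] : DfF fun v => F (s v) (t v) where
  out := by
    have := hs.lift
    have := ht.lift
    exact Df.comp₃ (P := fun y x x' => y = F x x') (h := h.out)

instance (priority := 500) {F : M → M → M → M} {s t u : (ℕ → M) → M}
    [h : DfF fun v : ℕ → M => F (v 0) (v 1) (v 2)]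
    [hs : DfF s] [ht : DfF t] [hu : DfF u] : DfF fun v => F (s v) (t v) (u v) where
  out := by
    have := hs.lift
    have := ht.lift
    have := hu.lift
    exact Df.comp₄ (P := fun y x x' x'' => y = F x x' x'') (h := h.out)

/-! Definability of the notions used in the statements. -/

instance : Df fun v : ℕ → M => Sub (v 0) (v 1) := by unfold Sub; infer_instance
instance : Df fun v : ℕ → M => Le (v 0) (v 1) := by unfold Le; infer_instance
instance : Df fun v : ℕ → M => IsPair (v 0) (v 1) (v 2) := by unfold IsPair; infer_instance
instance : Df fun v : ℕ → M => App (v 0) (v 1) (v 2) := by unfold App; infer_instance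
instance : Df fun v : ℕ → M => IsTrans (v 0) := by unfold IsTrans; infer_instance
instance : Df fun v : ℕ → M => IsOrd (v 0) := by unfold IsOrd; infer_instance
instance : Df fun v : ℕ → M => IsLimit (v 0) := by unfold IsLimit; infer_instance

end Definability

/-! ### Basic set operations -/

/-- `M` is a model of ZF, as a type class. -/
class ZFModel (M : Type*) [setLang.Structure M] : Prop where
  out : ModelsZF M

section Basic

variable {M : Type*} [setLang.Structure M] [hM : ZFModel M]

instance ZFModel.nonempty : Nonempty M := by
  obtain ⟨w, -⟩ := hM.out.infinity
  exact ⟨w⟩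

theorem separation (P : M → Prop) [h : Df fun v : ℕ → M => P (v 0)] (a : M) :
    ∃ b : M, ∀ z : M, z ∊ b ↔ z ∊ a ∧ P z := by
  refine hM.out.separation {x | P x} ?_ a
  obtain ⟨φ, hφ⟩ := h.out
  -- Merging all variables into one is harmless, because `P` reads only `v 0`.
  refine ⟨φ.relabel fun _ => 0, ?_⟩
  ext x
  change P (x 0) ↔ (φ.relabel fun _ => (0 : Fin 1)).Realize x
  rw [FirstOrder.Language.Formula.realize_relabel, hφ]
  rfl

theorem replacement (R : M → M → Prop) [h : Df fun v : ℕ → M => R (v 0) (v 1)] (a : M)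
    (H : ∀ x : M, x ∊ a → ∃! y : M, R x y) :
    ∃ b : M, ∀ y : M, y ∊ b ↔ ∃ x : M, x ∊ a ∧ R x y := by
  refine hM.out.replacement {p | R p.1 p.2} ?_ a H
  obtain ⟨φ, hφ⟩ := h.out
  refine ⟨φ.relabel fun n => Nat.casesOn n 0 fun _ => 1, ?_⟩
  ext x
  change R (x 0) (x 1) ↔ (φ.relabel fun n => Nat.casesOn n (0 : Fin 2) fun _ => 1).Realize x
  rw [FirstOrder.Language.Formula.realize_relabel, hφ]
  rfl

theorem ext_of {x y : M} (h : ∀ z : M, z ∊ x ↔ z ∊ y) : x = y := hM.out.extensionality x y h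

open Classical in
/-- The unique `y` such that `P y`, if there is one. -/
noncomputable def the (P : M → Prop) : M :=
  if h : ∃! y, P y then h.choose else Classical.epsilon fun _ => True

theorem the_spec {P : M → Prop} (h : ∃! y, P y) : P (the P) := by
  rw [the, dif_pos h]; exact h.choose_spec.1

theorem the_eq {P : M → Prop} {y : M} (h : P y) (h' : ∀ z, P z → z = y) : the P = y :=
  h' _ (the_spec ⟨y, h, h'⟩)

/-- The default value of `the` is a fixed element of `M`, hence a parameter, so the case split on
unique existence is first-order. -/
instance {P : (ℕ → M) → M → Prop} [h : Df fun w : ℕ → M => P (fun n => w (n + 1)) (w 0)] :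
    DfF fun v => the (P v) where
  out := by
    have h1 : Df fun w : ℕ → M => P (fun n => w (n + 2)) (w 0) :=
      (h.rename fun k => Nat.casesOn k 0 fun n => n + 2).congr fun v => Iff.rfl
    have h2 : Df fun w : ℕ → M => P (fun n => w (n + 3)) (w 0) :=
      (h.rename fun k => Nat.casesOn k 0 fun n => n + 3).congr fun v => Iff.rfl
    have h3 : Df fun w : ℕ → M => P (fun n => w (n + 3)) (w 1) :=
      (h.rename fun k => Nat.casesOn k 1 fun n => n + 3).congr fun v => Iff.rfl
    refine Df.congr (P := fun v => (P (fun n => v (n + 1)) (v 0) ∧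
      ∀ y, P (fun n => v (n + 1)) y → y = v 0) ∨
      (¬ ∃ y, P (fun n => v (n + 1)) y ∧ ∀ z, P (fun n => v (n + 1)) z → z = y) ∧
        v 0 = Classical.epsilon fun _ => True) inferInstance fun v => ?_
    by_cases H : ∃! y, P (fun n => v (n + 1)) y
    · have := the_spec H
      constructor
      · intro e
        rw [e]
        exact Or.inl ⟨this, fun y hy => H.unique hy this⟩
      · rintro (e | e)
        · exact (the_eq e.1 e.2).symm
        · exact absurd H e.1
    · rw [the, dif_neg H]
      constructor
      · exact fun e => Or.inr ⟨H, e⟩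
      · rintro (e | e)
        · exact absurd ⟨_, e⟩ H
        · exact e.2

/-- The set of all `z` such that `P z`, if this is a set. -/
noncomputable def cl (P : M → Prop) : M := the fun b => ∀ z, z ∊ b ↔ P z

instance {P : (ℕ → M) → M → Prop} [h : Df fun w : ℕ → M => P (fun n => w (n + 1)) (w 0)] :
    DfF fun v => cl (P v) := by
  have : Df fun w : ℕ → M => P (fun n => w (n + 2)) (w 0) :=
      (h.rename fun k => Nat.casesOn k 0 fun n => n + 2).congr fun v => Iff.rfl
  unfold cl
  infer_instance

theorem mem_cl {P : M → Prop} (h : ∃ b : M, ∀ z, z ∊ b ↔ P z) {z : M} : z ∊ cl P ↔ P z := by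
  obtain ⟨b, hb⟩ := h
  have := the_spec (P := fun b : M => ∀ z, z ∊ b ↔ P z)
    ⟨b, hb, fun c hc => ext_of fun z => (hc z).trans (hb z).symm⟩
  exact this z

noncomputable def sep (a : M) (P : M → Prop) : M := cl fun z => z ∊ a ∧ P z
noncomputable def upair (x y : M) : M := cl fun z => z = x ∨ z = y
noncomputable def pr (x y : M) : M := upair (upair x x) (upair x y)
noncomputable def sUnion (a : M) : M := cl fun z => ∃ y, y ∊ a ∧ z ∊ y
noncomputable def pow (a : M) : M := cl fun z => Sub z a
/-- The image of `a` under `F`. -/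
noncomputable def img (a : M) (F : M → M) : M := cl fun z => ∃ x, x ∊ a ∧ z = F x
/-- `F` restricted to `a`, as a set. -/
noncomputable def graph (F : M → M) (a : M) : M := cl fun z => ∃ x, x ∊ a ∧ z = pr x (F x)
noncomputable def succ (a : M) : M := cl fun z => z ∊ a ∨ z = a
noncomputable def emp : M := cl fun _ => False
/-- The value of the function `f` at `x`. -/
noncomputable def ap (f x : M) : M := the fun y => App f x y

instance : DfF fun v : ℕ → M => upair (v 0) (v 1) := by unfold upair; infer_instance
instance : DfF fun v : ℕ → M => pr (v 0) (v 1) := by unfold pr; infer_instance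
instance : DfF fun v : ℕ → M => sUnion (v 0) := by unfold sUnion; infer_instance
instance : DfF fun v : ℕ → M => succ (v 0) := by unfold succ; infer_instance
instance : DfF fun v : ℕ → M => ap (v 0) (v 1) := by unfold ap; infer_instance

instance {s : (ℕ → M) → M} {P : (ℕ → M) → M → Prop} [hs : DfF s]
    [h : Df fun w : ℕ → M => P (fun n => w (n + 1)) (w 0)] : DfF fun v => sep (s v) (P v) := by
  have := hs.lift
  unfold sep
  infer_instance

instance {s : (ℕ → M) → M} {F : (ℕ → M) → M → M} [hs : DfF s]
    [h : DfF fun w : ℕ → M => F (fun n => w (n + 1)) (w 0)] : DfF fun v => img (s v) (F v) := by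
  have := hs.lift.lift
  have := h.lift_second
  unfold img
  infer_instance

instance {s : (ℕ → M) → M} {F : (ℕ → M) → M → M} [hs : DfF s]
    [h : DfF fun w : ℕ → M => F (fun n => w (n + 1)) (w 0)] : DfF fun v => graph (F v) (s v) := by
  have := hs.lift.lift
  have := h.lift_second
  unfold graph
  infer_instance

theorem mem_sep {P : M → Prop} [Df fun v : ℕ → M => P (v 0)] {a z : M} :
    z ∊ sep a P ↔ z ∊ a ∧ P z := mem_cl (separation P a)

theorem mem_upair {x y z : M} : z ∊ upair x y ↔ z = x ∨ z = y := mem_cl (hM.out.pairing x y)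

theorem mem_sUnion {a z : M} : z ∊ sUnion a ↔ ∃ y, y ∊ a ∧ z ∊ y := mem_cl (hM.out.union a)

theorem mem_pow {a z : M} : z ∊ pow a ↔ Sub z a := mem_cl (hM.out.power a)

theorem mem_img {F : M → M} [h : DfF fun v : ℕ → M => F (v 0)] {a z : M} :
    z ∊ img a F ↔ ∃ x, x ∊ a ∧ z = F x :=
  mem_cl (replacement (fun x y => y = F x) a fun x _ => ⟨F x, rfl, fun _ h => h⟩)

theorem mem_graph {F : M → M} [h : DfF fun v : ℕ → M => F (v 0)] {a z : M} :
    z ∊ graph F a ↔ ∃ x, x ∊ a ∧ z = pr x (F x) :=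
  mem_cl (replacement (fun x y => y = pr x (F x)) a fun x _ => ⟨pr x (F x), rfl, fun _ h => h⟩)

theorem mem_succ {a z : M} : z ∊ succ a ↔ Le z a := by
  refine mem_cl ⟨sUnion (upair a (upair a a)), fun _ => ?_⟩
  simp only [mem_sUnion, mem_upair]
  constructor
  · rintro ⟨y, rfl | rfl, h⟩
    · exact Or.inl h
    · exact Or.inr (by simpa [mem_upair] using h)
  · rintro (h | h)
    · exact ⟨a, Or.inl rfl, h⟩
    · exact ⟨_, Or.inr rfl, by simpa [mem_upair] using h⟩

theorem not_mem_emp {z : M} : ¬ z ∊ (emp : M) := by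
  have h : ∃ b : M, ∀ z : M, z ∊ b ↔ False := by
    obtain ⟨w⟩ := ZFModel.nonempty (M := M)
    obtain ⟨b, hb⟩ := separation (fun x : M => ¬ x = x) w
    exact ⟨b, fun z => by simp [hb]⟩
  exact fun hz => (mem_cl h).1 hz

theorem isSucc_iff {a s : M} : IsSucc a s ↔ s = succ a :=
  ⟨fun h => ext_of fun z => (h z).trans mem_succ.symm, fun h z => h ▸ mem_succ⟩

theorem isPair_iff {p x y : M} : IsPair p x y ↔ p = pr x y := by
  have key : ∀ z : M, z ∊ pr x y ↔
      (∀ w : M, w ∊ z ↔ w = x) ∨ (∀ w : M, w ∊ z ↔ w = x ∨ w = y) := by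
    intro z
    rw [pr, mem_upair]
    refine or_congr ⟨?_, fun h => ext_of fun w => ?_⟩ ⟨?_, fun h => ext_of fun w => ?_⟩
    · rintro rfl w; simp [mem_upair]
    · simp [mem_upair, h]
    · rintro rfl w; simp [mem_upair]
    · simp [mem_upair, h]
  exact ⟨fun h => ext_of fun z => (h z).trans (key z).symm, fun h => h ▸ key⟩

theorem upair_inj_right {x y z : M} (h : upair x y = upair x z) : y = z := by
  have h1 : y ∊ upair x z := h ▸ mem_upair.2 (Or.inr rfl)
  have h2 : z ∊ upair x y := h ▸ mem_upair.2 (Or.inr rfl)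
  rw [mem_upair] at h1 h2
  rcases h1 with h1 | h1
  · rcases h2 with h2 | h2
    · rw [h1, h2]
    · exact h2.symm
  · exact h1

theorem pr_inj {x y x' y' : M} (h : pr x y = pr x' y') : x = x' ∧ y = y' := by
  have hx : x = x' := by
    have h1 : upair x x ∊ pr x' y' := h ▸ mem_upair.2 (Or.inl rfl)
    rcases mem_upair.1 h1 with h2 | h2
    · have : x ∊ upair x' x' := h2 ▸ mem_upair.2 (Or.inl rfl)
      rw [mem_upair] at this; tauto
    · have : x' ∊ upair x x := h2 ▸ mem_upair.2 (Or.inl rfl)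
      rw [mem_upair] at this
      tauto
  subst hx
  exact ⟨rfl, upair_inj_right (upair_inj_right h)⟩

theorem app_iff {f x y : M} : App f x y ↔ pr x y ∊ f :=
  ⟨fun ⟨p, hp, h⟩ => isPair_iff.1 h ▸ hp, fun h => ⟨_, h, isPair_iff.2 rfl⟩⟩

theorem app_graph {F : M → M} [DfF fun v : ℕ → M => F (v 0)] {a x y : M} :
    App (graph F a) x y ↔ x ∊ a ∧ y = F x := by
  rw [app_iff, mem_graph]
  constructor
  · rintro ⟨x', h, e⟩
    obtain ⟨rfl, rfl⟩ := pr_inj e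
    exact ⟨h, rfl⟩
  · rintro ⟨h, rfl⟩
    exact ⟨x, h, rfl⟩

theorem funOn_graph {F : M → M} [DfF fun v : ℕ → M => F (v 0)] {a : M} {A : Set M}
    (hA : ∀ x, x ∈ A ↔ x ∊ a) : FunOn (graph F a) A := by
  constructor
  · intro _ hp
    obtain ⟨x, hx, e⟩ := mem_graph.1 hp
    exact ⟨x, F x, isPair_iff.2 e, (hA x).2 hx⟩
  · intro x hx
    exact ⟨F x, app_graph.2 ⟨(hA x).1 hx, rfl⟩, fun y hy => (app_graph.1 hy).2⟩

theorem funTo_graph {F : M → M} [DfF fun v : ℕ → M => F (v 0)] {a : M} {A B : Set M}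
    (hA : ∀ x, x ∈ A ↔ x ∊ a) (hB : ∀ x, x ∊ a → F x ∈ B) : FunTo (graph F a) A B :=
  ⟨funOn_graph hA, fun _ _ h => (app_graph.1 h).2 ▸ hB _ (app_graph.1 h).1⟩

theorem FunOn.mem {f x y : M} {A : Set M} (hf : FunOn f A) (h : App f x y) : x ∈ A := by
  obtain ⟨x', y', e, hx⟩ := hf.1 _ (app_iff.1 h)
  rw [isPair_iff] at e
  rwa [(pr_inj e).1]

theorem FunOn.app_iff {f x y : M} {A : Set M} (hf : FunOn f A) (hx : x ∈ A) :
    App f x y ↔ y = ap f x := by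
  have h : App f x (ap f x) := the_spec (hf.2 x hx)
  constructor
  · exact fun h' => (hf.2 x hx).unique h' h
  · rintro rfl; exact h

theorem FunOn.app {f x : M} {A : Set M} (hf : FunOn f A) (hx : x ∈ A) : App f x (ap f x) :=
  (hf.app_iff hx).2 rfl

theorem ap_graph {F : M → M} [DfF fun v : ℕ → M => F (v 0)] {a x : M} (hx : x ∊ a) :
    ap (graph F a) x = F x :=
  the_eq (app_graph.2 ⟨hx, rfl⟩) fun _ h => (app_graph.1 h).2

end Basic

/-! ### Ordinals -/

section Ordinals

variable {M : Type*} [setLang.Structure M] [hM : ZFModel M]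

theorem exists_minimal (a : M) (P : M → Prop) [Df fun v : ℕ → M => P (v 0)]
    (h : ∃ x, x ∊ a ∧ P x) : ∃ x, x ∊ a ∧ P x ∧ ∀ y, y ∊ x → y ∊ a → ¬ P y := by
  obtain ⟨x, hx, hP⟩ := h
  obtain ⟨y, hy, hmin⟩ := hM.out.foundation (sep a P) ⟨x, mem_sep.2 ⟨hx, hP⟩⟩
  rw [mem_sep] at hy
  exact ⟨y, hy.1, hy.2, fun z hz hza hPz => hmin z hz (mem_sep.2 ⟨hza, hPz⟩)⟩

theorem mem_irrefl (a : M) : ¬ a ∊ a := by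
  intro h
  obtain ⟨x, hx, hmin⟩ := hM.out.foundation (upair a a) ⟨a, mem_upair.2 (Or.inl rfl)⟩
  have : x = a := by simpa [mem_upair] using hx
  subst this
  exact hmin x h hx

theorem mem_asymm {a b : M} (h : a ∊ b) (h' : b ∊ a) : False := by
  obtain ⟨x, hx, hmin⟩ := hM.out.foundation (upair a b) ⟨a, mem_upair.2 (Or.inl rfl)⟩
  rcases mem_upair.1 hx with rfl | rfl
  · exact hmin b h' (mem_upair.2 (Or.inr rfl))
  · exact hmin a h (mem_upair.2 (Or.inl rfl))

theorem IsOrd.mem {a b : M} (hb : IsOrd b) (h : a ∊ b) : IsOrd a :=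
  ⟨hb.2 a h, fun x hx => hb.2 x (hb.1 a h x hx)⟩

theorem IsOrd.trans {a b c : M} (hc : IsOrd c) (h : a ∊ b) (h' : b ∊ c) : a ∊ c :=
  hc.1 b h' a h

theorem IsOrd.induct (P : M → Prop) [Df fun v : ℕ → M => P (v 0)]
    (h : ∀ a, IsOrd a → (∀ b, b ∊ a → P b) → P a) (a : M) (ha : IsOrd a) : P a := by
  by_contra hP
  obtain ⟨x, hx, hPx, hmin⟩ := exists_minimal (succ a) (fun x => ¬ P x)
    ⟨a, mem_succ.2 (Or.inr rfl), hP⟩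
  have hxo : IsOrd x := by
    rcases mem_succ.1 hx with hx | rfl
    · exact ha.mem hx
    · exact ha
  refine hPx (h x hxo fun b hb => ?_)
  refine not_not.1 (hmin b hb (mem_succ.2 (Or.inl ?_)))
  rcases mem_succ.1 hx with hx | rfl
  · exact ha.trans hb hx
  · exact hb

theorem IsOrd.trichotomy {a b : M} (ha : IsOrd a) (hb : IsOrd b) : a ∊ b ∨ a = b ∨ b ∊ a := by
  refine IsOrd.induct (fun a => ∀ b, IsOrd b → a ∊ b ∨ a = b ∨ b ∊ a) ?_ a ha b hb
  intro a ha iha b hb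
  refine IsOrd.induct (fun b => a ∊ b ∨ a = b ∨ b ∊ a) ?_ b hb
  intro b hb ihb
  by_cases h1 : ∃ d, d ∊ b ∧ (a ∊ d ∨ a = d)
  · obtain ⟨d, hd, h | rfl⟩ := h1
    · exact Or.inl (hb.trans h hd)
    · exact Or.inl hd
  by_cases h2 : ∃ c, c ∊ a ∧ (b ∊ c ∨ c = b)
  · obtain ⟨c, hc, h | rfl⟩ := h2
    · exact Or.inr (Or.inr (ha.trans h hc))
    · exact Or.inr (Or.inr hc)
  refine Or.inr (Or.inl (ext_of fun z => ⟨fun hz => ?_, fun hz => ?_⟩))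
  · rcases iha z hz b hb with h | h | h
    · exact h
    · exact absurd ⟨z, hz, Or.inr h⟩ h2
    · exact absurd ⟨z, hz, Or.inl h⟩ h2
  · rcases ihb z hz with h | h | h
    · exact absurd ⟨z, hz, Or.inl h⟩ h1
    · exact absurd ⟨z, hz, Or.inr h⟩ h1
    · exact h

theorem Le.refl (a : M) : Le a a := Or.inr rfl

theorem mem_of_le_of_mem {a b c : M} (hc : IsOrd c) (h : Le a b) (h' : b ∊ c) : a ∊ c := by
  rcases h with h | rfl
  · exact hc.trans h h'
  · exact h'

theorem mem_of_mem_of_le {a b c : M} (hc : IsOrd c) (h : a ∊ b) (h' : Le b c) : a ∊ c := by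
  rcases h' with h' | rfl
  · exact hc.trans h h'
  · exact h

theorem Le.trans {a b c : M} (hc : IsOrd c) (h : Le a b) (h' : Le b c) : Le a c := by
  rcases h with h | rfl
  · exact Or.inl (mem_of_mem_of_le hc h h')
  · exact h'

theorem IsOrd.not_mem {a b : M} (ha : IsOrd a) (hb : IsOrd b) : ¬ a ∊ b ↔ Le b a := by
  constructor
  · intro h
    rcases ha.trichotomy hb with h' | h' | h'
    · exact absurd h' h
    · exact Or.inr h'.symm
    · exact Or.inl h'
  · rintro (h | rfl) h'
    · exact mem_asymm h h'
    · exact mem_irrefl _ h'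

theorem IsOrd.not_le {a b : M} (ha : IsOrd a) (hb : IsOrd b) : ¬ Le a b ↔ b ∊ a := by
  rw [← hb.not_mem ha, not_not]

theorem Le.not_mem {a b : M} (h : Le a b) : ¬ b ∊ a := by
  rintro h'
  rcases h with h | rfl
  · exact mem_asymm h h'
  · exact mem_irrefl _ h'

theorem IsOrd.le_iff_sub {a b : M} (ha : IsOrd a) (hb : IsOrd b) : Le a b ↔ Sub a b := by
  constructor
  · intro h z hz
    exact mem_of_mem_of_le hb hz h
  · intro h
    rw [← hb.not_mem ha]
    exact fun h' => mem_irrefl _ (h _ h')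

theorem IsOrd.succ {a : M} (ha : IsOrd a) : IsOrd (succ a) := by
  refine ⟨fun x hx z hz => ?_, fun x hx => ?_⟩
  · exact mem_succ.2 (Or.inl (mem_of_mem_of_le ha hz (mem_succ.1 hx)))
  · rcases mem_succ.1 hx with hx | rfl
    · exact ha.2 x hx
    · exact ha.1

theorem mem_succ_self (a : M) : a ∊ succ a := mem_succ.2 (Or.inr rfl)

theorem succ_le {a b : M} (ha : IsOrd a) (hb : IsOrd b) : Le (succ a) b ↔ a ∊ b := by
  constructor
  · exact fun h => mem_of_mem_of_le hb (mem_succ_self a) h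
  · intro h
    rw [ha.succ.le_iff_sub hb]
    exact fun z hz => mem_of_le_of_mem hb (mem_succ.1 hz) h

theorem isOrd_emp : IsOrd (emp : M) :=
  ⟨fun _ h => absurd h not_mem_emp, fun _ h => absurd h not_mem_emp⟩

theorem emp_le {a : M} (ha : IsOrd a) : Le emp a :=
  (isOrd_emp.le_iff_sub ha).2 fun _ h => absurd h not_mem_emp

theorem isOrd_sUnion {a : M} (h : ∀ x, x ∊ a → IsOrd x) : IsOrd (sUnion a) := by
  refine ⟨fun x hx z hz => ?_, fun x hx => ?_⟩
  · obtain ⟨y, hy, hxy⟩ := mem_sUnion.1 hx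
    exact mem_sUnion.2 ⟨y, hy, (h y hy).trans hz hxy⟩
  · obtain ⟨y, hy, hxy⟩ := mem_sUnion.1 hx
    exact (h y hy).2 x hxy

theorem IsLimit.succ_mem {a x : M} (ha : IsLimit a) (hx : x ∊ a) : ZFM.succ x ∊ a := by
  obtain ⟨y, hy, hxy⟩ := ha.2.2 x hx
  exact mem_of_le_of_mem ha.1 ((succ_le (ha.1.mem hx) (ha.1.mem hy)).2 hxy) hy

theorem IsLimit.emp_mem {a : M} (ha : IsLimit a) : emp ∊ a := by
  obtain ⟨x, hx⟩ := ha.2.1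
  exact mem_of_le_of_mem ha.1 (emp_le (ha.1.mem hx)) hx

/-- The least ordinal such that `P`, if there is one. -/
noncomputable def leastOrd (P : M → Prop) : M :=
  the fun a => IsOrd a ∧ P a ∧ ∀ b, b ∊ a → ¬ P b

instance {P : (ℕ → M) → M → Prop} [h : Df fun w : ℕ → M => P (fun n => w (n + 1)) (w 0)] :
    DfF fun v => leastOrd (P v) := by
  have : Df fun w : ℕ → M => P (fun n => w (n + 2)) (w 0) :=
      (h.rename fun k => Nat.casesOn k 0 fun n => n + 2).congr fun v => Iff.rfl
  unfold leastOrd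
  infer_instance

theorem leastOrd_spec {P : M → Prop} [Df fun v : ℕ → M => P (v 0)] (h : ∃ a, IsOrd a ∧ P a) :
    IsOrd (leastOrd P) ∧ P (leastOrd P) ∧ ∀ b, b ∊ leastOrd P → ¬ P b := by
  refine the_spec (P := fun a => IsOrd a ∧ P a ∧ ∀ b, b ∊ a → ¬ P b) ?_
  obtain ⟨a, ha, hP⟩ := h
  have : ∃ x, IsOrd x ∧ P x ∧ ∀ y, y ∊ x → ¬ P y := by
    obtain ⟨x, hx, hPx, hmin⟩ := exists_minimal (ZFM.succ a) P ⟨a, mem_succ_self a, hP⟩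
    exact ⟨x, ha.succ.mem hx, hPx, fun y hy => hmin y hy (ha.succ.trans hy hx)⟩
  obtain ⟨x, hx, hPx, hmin⟩ := this
  refine ⟨x, ⟨hx, hPx, hmin⟩, ?_⟩
  rintro y ⟨hy, hPy, hminy⟩
  rcases hx.trichotomy hy with h | h | h
  · exact absurd hPx (hminy x h)
  · exact h.symm
  · exact absurd hPy (hmin y h)

theorem leastOrd_le {P : M → Prop} [Df fun v : ℕ → M => P (v 0)] {a : M} (ha : IsOrd a)
    (h : P a) : Le (leastOrd P) a := by
  obtain ⟨h1, -, h3⟩ := leastOrd_spec ⟨a, ha, h⟩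
  rw [← ha.not_mem h1]
  exact fun h' => h3 _ h' h

/-! ### Transfinite recursion -/

/-- `f` is a function on `a` with `f(x) = ⋃ {N(p, b, f(b)) : b ∈ x}`. -/
def IsRun (N : M → M → M → M) (p f a : M) : Prop :=
  IsOrd a ∧ FunOn f (ext a) ∧ ∀ x, x ∊ a → ap f x = sUnion (img x fun b => N p b (ap f b))

/-- The function with `iter N p a = ⋃ {N(p, b, iter N p b) : b ∈ a}` for all ordinals `a`. -/
noncomputable def iter (N : M → M → M → M) (p a : M) : M :=
  the fun y => ∃ f, IsRun N p f (succ a) ∧ y = ap f a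

instance : Df fun v : ℕ → M => FunOn (v 0) (ext (v 1)) := by
  change Df fun v : ℕ → M => (∀ p : M, p ∊ v 0 → ∃ x y : M, IsPair p x y ∧ x ∊ v 1) ∧
    ∀ x, x ∊ v 1 → ∃ y : M, App (v 0) x y ∧ ∀ z : M, App (v 0) x z → z = y
  infer_instance

section

variable {N : M → M → M → M} [hN : DfF fun v : ℕ → M => N (v 0) (v 1) (v 2)]

instance : Df fun v : ℕ → M => IsRun N (v 0) (v 1) (v 2) := by
  unfold IsRun
  have : Df fun v : ℕ → M => FunOn (v 1) (ext (v 2)) :=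
    Df.comp₂ (P := fun x y => FunOn x (ext y))
  infer_instance

instance : DfF fun v : ℕ → M => iter N (v 0) (v 1) := by
  unfold iter
  infer_instance

theorem IsRun.agree {p f a f' a' : M} (h : IsRun N p f a) (h' : IsRun N p f' a') (x : M)
    (hx : x ∊ a) (hx' : x ∊ a') : ap f x = ap f' x := by
  refine IsOrd.induct (fun x => x ∊ a → x ∊ a' → ap f x = ap f' x) ?_ x (h.1.mem hx) hx hx'
  intro x hxo ih hx hx'
  rw [h.2.2 x hx, h'.2.2 x hx']
  congr 1
  refine ext_of fun z => ?_
  rw [mem_img, mem_img]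
  refine exists_congr fun b => and_congr_right fun hb => ?_
  rw [ih b hb (h.1.trans hb hx) (h'.1.trans hb hx')]

theorem iter_eq_ap {p f a x : M} (h : IsRun N p f a) (hx : x ∊ a)
    (hf : ∃ g, IsRun N p g (succ x)) : iter N p x = ap f x := by
  obtain ⟨g, hg⟩ := hf
  refine the_eq ⟨g, hg, (hg.agree h x (mem_succ_self x) hx).symm⟩ ?_
  rintro z ⟨g', hg', rfl⟩
  exact hg'.agree h x (mem_succ_self x) hx

/-- Below `a` the values of `iter` are already correct by induction, so the recursion clause applied
to them is a definable function, and its graph on `succ a` is a run. -/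
theorem exists_isRun (p a : M) (ha : IsOrd a) : ∃ f, IsRun N p f (succ a) := by
  refine IsOrd.induct (fun a => ∃ f, IsRun N p f (succ a)) ?_ a ha
  intro a ha ih
  have hF : DfF fun v : ℕ → M => sUnion (img (v 0) fun b => N p b (iter N p b)) := inferInstance
  have key : ∀ x, x ∊ a → iter N p x = sUnion (img x fun b => N p b (iter N p b)) := by
    intro x hx
    obtain ⟨f, hf⟩ := ih x hx
    rw [iter_eq_ap hf (mem_succ_self x) (ih x hx), hf.2.2 x (mem_succ_self x)]
    congr 1
    refine ext_of fun z => ?_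
    rw [mem_img, mem_img]
    refine exists_congr fun b => and_congr_right fun hb => ?_
    rw [iter_eq_ap hf (mem_succ.2 (Or.inl hb)) (ih b (ha.trans hb hx))]
  refine ⟨graph (fun x => sUnion (img x fun b => N p b (iter N p b))) (succ a), ha.succ,
    funOn_graph fun x => Iff.rfl, fun x hx => ?_⟩
  rw [ap_graph hx]
  refine congrArg sUnion (ext_of fun z => ?_)
  rw [mem_img, mem_img]
  refine exists_congr fun b => and_congr_right fun hb => ?_
  have hba : b ∊ a := mem_of_mem_of_le ha hb (mem_succ.1 hx)
  rw [ap_graph (mem_succ.2 (Or.inl hba)), key b hba]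

/-- One clause covers zero, successors and limits. For ordinal values it is a supremum over earlier
stages, so sequences built by `iter` start at 0 and are continuous. -/
theorem mem_iter {p a z : M} (ha : IsOrd a) :
    z ∊ iter N p a ↔ ∃ b, b ∊ a ∧ z ∊ N p b (iter N p b) := by
  obtain ⟨f, hf⟩ := exists_isRun (N := N) p a ha
  rw [iter_eq_ap hf (mem_succ_self a) ⟨f, hf⟩, hf.2.2 a (mem_succ_self a), mem_sUnion]
  have e : ∀ b, b ∊ a → ap f b = iter N p b := fun b hb =>
    (iter_eq_ap hf (mem_succ.2 (Or.inl hb)) (exists_isRun p b (ha.mem hb))).symm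
  constructor
  · rintro ⟨y, hy, hz⟩
    obtain ⟨b, hb, rfl⟩ := mem_img.1 hy
    exact ⟨b, hb, e b hb ▸ hz⟩
  · rintro ⟨b, hb, hz⟩
    exact ⟨_, mem_img.2 ⟨b, hb, rfl⟩, (e b hb).symm ▸ hz⟩

end

end Ordinals

/-! ### Cofinality and closed unbounded sets -/

section Cofinality

variable {M : Type*} [setLang.Structure M] [hM : ZFModel M]

instance : Df fun v : ℕ → M => CofinalMap (v 0) (v 1) (v 2) := by
  change Df fun v : ℕ → M => ((FunOn (v 0) (ext (v 1))) ∧ ∀ x y : M, App (v 0) x y → y ∊ v 2) ∧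
    (∀ y : M, (∃ i : M, App (v 0) i y) → y ∊ v 2) ∧
    ∀ x : M, x ∊ v 2 → ∃ y : M, (∃ i : M, App (v 0) i y) ∧ Le x y
  have := Df.comp₂ (P := fun x y : M => FunOn x (ext y)) (s := fun v => v 0) (t := fun v => v 1)
  infer_instance

instance : Df fun v : ℕ → M => IsCof (v 0) (v 1) := by unfold IsCof; infer_instance

instance : Df fun v : ℕ → M => Club (v 0) (v 1) := by
  change Df fun v : ℕ → M => ((∀ x : M, x ∊ v 0 → x ∊ v 1) ∧
    ∀ x : M, x ∊ v 1 → ∃ y : M, y ∊ v 0 ∧ Le x y) ∧ ∀ d : M, d ∊ v 1 → IsLimit d →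
    ((∀ x : M, x ∊ v 0 ∧ x ∊ d → x ∊ d) ∧ ∀ x : M, x ∊ d → ∃ y : M, (y ∊ v 0 ∧ y ∊ d) ∧ Le x y) →
    d ∊ v 0
  infer_instance

theorem isOrd_iter {N : M → M → M → M} [hN : DfF fun v : ℕ → M => N (v 0) (v 1) (v 2)] {p a : M}
    (ha : IsOrd a) (h : ∀ b, b ∊ a → IsOrd (N p b (iter N p b))) : IsOrd (iter N p a) := by
  refine ⟨fun x hx z hz => ?_, fun x hx => ?_⟩
  · obtain ⟨b, hb, hxb⟩ := (mem_iter ha).1 hx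
    exact (mem_iter ha).2 ⟨b, hb, (h b hb).trans hz hxb⟩
  · obtain ⟨b, hb, hxb⟩ := (mem_iter ha).1 hx
    exact (h b hb).2 x hxb

/-- A map from an ordinal below the cofinality does not have cofinal range; the negation of
cofinality yields a strict bound. -/
theorem IsCof.bound {lam k m : M} (h : IsCof lam k) (hm : m ∊ k) (F : M → M)
    [DfF fun v : ℕ → M => F (v 0)] (hF : ∀ i, i ∊ m → F i ∊ lam) :
    ∃ x, x ∊ lam ∧ ∀ i, i ∊ m → F i ∊ x := by
  by_contra H
  push Not at H
  refine h.2.2.2 m hm ⟨graph F m, funTo_graph (fun _ => Iff.rfl) hF, ?_, fun x hx => ?_⟩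
  · rintro y ⟨i, hi⟩
    obtain ⟨him, rfl⟩ := app_graph.1 hi
    exact hF i him
  · obtain ⟨i, hi, hix⟩ := H x hx
    exact ⟨F i, ⟨i, app_graph.2 ⟨hi, rfl⟩⟩, ((h.1.mem (hF i hi)).not_mem (h.1.mem hx)).1 hix⟩

/-- `lam` has cofinality greater than the limit ordinal `θ`. -/
theorem IsCof.isLimit {lam k θ : M} (h : IsCof lam k) (hθ : IsLimit θ) (hk : θ ∊ k) :
    IsLimit lam := by
  have h0 : emp ∊ k := h.2.1.trans hθ.emp_mem hk
  have h1 : succ emp ∊ k := h.2.1.trans (hθ.succ_mem hθ.emp_mem) hk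
  refine ⟨h.1, ?_, fun x hx => ?_⟩
  · by_contra H
    push Not at H
    refine h.2.2.2 emp h0 ⟨graph (fun x => x) emp, funTo_graph (fun _ => Iff.rfl)
      fun _ hx => absurd hx not_mem_emp, ?_, fun x hx => absurd hx (H x)⟩
    rintro y ⟨i, hi⟩
    exact absurd (app_graph.1 hi).1 not_mem_emp
  · obtain ⟨y, hy, H⟩ := h.bound h1 (fun _ => x) fun _ _ => hx
    exact ⟨y, hy, H emp (mem_succ_self _)⟩

/-- Closure points of a definable relation. -/
theorem IsCof.exists_closure_point {lam k θ x₀ : M} (h : IsCof lam k) (hθ : IsLimit θ)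
    (hk : θ ∊ k) (Q : M → M → Prop) [Df fun v : ℕ → M => Q (v 0) (v 1)]
    (hQ : ∀ x, x ∊ lam → ∃ y, y ∊ lam ∧ Q x y)
    (hmono : ∀ x x' y, x ∊ lam → x' ∊ x → Q x y → Q x' y) (hx₀ : x₀ ∊ lam)
    (hup : ∀ x y y', y' ∊ lam → y ∊ y' → Q x y → Q x y') :
    ∃ d, d ∊ lam ∧ IsLimit d ∧ x₀ ∊ d ∧ ∀ x, x ∊ d → ∃ y, y ∊ d ∧ Q x y := by
  have hl := h.isLimit hθ hk
  let P : M → M → Prop := fun x y => x ∊ y ∧ x₀ ∊ y ∧ y ∊ lam ∧ Q x y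
  have hPdf : Df fun v : ℕ → M => P (v 0) (v 1) :=
    inferInstanceAs (Df fun v : ℕ → M => v 0 ∊ v 1 ∧ x₀ ∊ v 1 ∧ v 1 ∊ lam ∧ Q (v 0) (v 1))
  let N : M → M → M → M := fun _ _ x => leastOrd (P x)
  have hN : DfF fun v : ℕ → M => N (v 0) (v 1) (v 2) :=
    inferInstanceAs (DfF fun v : ℕ → M => leastOrd (P (v 2)))
  have spec : ∀ x, x ∊ lam → IsOrd (leastOrd (P x)) ∧ P x (leastOrd (P x)) := by
    intro x hx
    suffices H : ∃ y, IsOrd y ∧ P x y from ⟨(leastOrd_spec H).1, (leastOrd_spec H).2.1⟩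
    obtain ⟨y, hy, hxy⟩ := hQ x hx
    -- Bounding a map on the ordinal 2 with values `x + 1` and `x₀ + 1` gives an element of `lam`
    -- above both `x` and `x₀`.
    obtain ⟨z, hz, H⟩ := h.bound (h.2.1.trans (hθ.succ_mem (hθ.succ_mem hθ.emp_mem)) hk)
      (fun i => the fun w => (i = emp ∧ w = ZFM.succ x) ∨ (i ≠ emp ∧ w = ZFM.succ x₀)) (by
        intro i _
        by_cases hi : i = emp
        · rw [the_eq (y := ZFM.succ x) (Or.inl ⟨hi, rfl⟩) (by tauto)]
          exact hl.succ_mem hx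
        · rw [the_eq (y := ZFM.succ x₀) (Or.inr ⟨hi, rfl⟩) (by tauto)]
          exact hl.succ_mem hx₀)
    have hzx : x ∊ z := by
      have := H emp (mem_succ.2 (Or.inl (mem_succ_self _)))
      rw [the_eq (y := ZFM.succ x) (Or.inl ⟨rfl, rfl⟩) (by tauto)] at this
      exact (h.1.mem hz).trans (mem_succ_self x) this
    have hzx₀ : x₀ ∊ z := by
      have := H (ZFM.succ emp) (mem_succ_self _)
      have hne : ZFM.succ emp ≠ (emp : M) := fun e => not_mem_emp (e ▸ mem_succ_self (emp : M))
      rw [the_eq (y := ZFM.succ x₀) (Or.inr ⟨hne, rfl⟩) (by tauto)] at this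
      exact (h.1.mem hz).trans (mem_succ_self x₀) this
    rcases (h.1.mem hy).trichotomy (h.1.mem hz) with hyz | rfl | hzy
    · exact ⟨z, h.1.mem hz, hzx, hzx₀, hz, hup _ _ _ hz hyz hxy⟩
    · exact ⟨y, h.1.mem hz, hzx, hzx₀, hz, hxy⟩
    · exact ⟨y, h.1.mem hy, (h.1.mem hy).trans hzx hzy, (h.1.mem hy).trans hzx₀ hzy, hy, hxy⟩
  -- Least witnesses are iterated θ times, so no choice is used. The stages stay below `lam` because
  -- `θ ∊ k`, and the stage `F θ` is the closure point.
  let F : M → M := iter N emp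
  have hF : DfF fun v : ℕ → M => F (v 0) := inferInstanceAs (DfF fun v : ℕ → M => iter N emp (v 0))
  have hFlam : ∀ a, IsOrd a → a ∊ k → F a ∊ lam := by
    refine IsOrd.induct (fun a => a ∊ k → F a ∊ lam) fun a ha ih hak => ?_
    have ih' : ∀ b, b ∊ a → F b ∊ lam := fun b hb => ih b hb (h.2.1.trans hb hak)
    obtain ⟨x, hx, H⟩ := h.bound hak (fun b => leastOrd (P (F b)))
      fun b hb => (spec _ (ih' b hb)).2.2.2.1
    have hFo : IsOrd (F a) := isOrd_iter ha fun b hb => (spec _ (ih' b hb)).1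
    refine mem_of_le_of_mem h.1 ((hFo.le_iff_sub (h.1.mem hx)).2 fun z hz => ?_) hx
    obtain ⟨b, hb, hzb⟩ := (mem_iter ha).1 hz
    exact (h.1.mem hx).trans hzb (H b hb)
  have hFθ : ∀ a, a ∊ θ → F a ∊ lam := fun a ha =>
    hFlam a (hθ.1.mem ha) (h.2.1.trans ha hk)
  have hmem : ∀ z, z ∊ F θ ↔ ∃ b, b ∊ θ ∧ z ∊ leastOrd (P (F b)) := fun z => mem_iter hθ.1
  have hle : ∀ a, a ∊ θ → Le (leastOrd (P (F a))) (F (ZFM.succ a)) := by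
    intro a ha
    have hsa := hθ.succ_mem ha
    rw [(spec _ (hFθ a ha)).1.le_iff_sub (h.1.mem (hFθ _ hsa))]
    exact fun z hz => (mem_iter (hθ.1.mem hsa)).2 ⟨a, mem_succ_self a, hz⟩
  have hstep : ∀ a, a ∊ θ → F a ∊ F θ := fun a ha =>
    (hmem _).2 ⟨a, ha, (spec _ (hFθ a ha)).2.1⟩
  have hd : F θ ∊ lam := hFlam θ hθ.1 hk
  have hdo := h.1.mem hd
  refine ⟨F θ, hd, ⟨hdo, ⟨F emp, hstep _ hθ.emp_mem⟩, fun x hx => ?_⟩,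
    (hmem _).2 ⟨emp, hθ.emp_mem, (spec _ (hFθ _ hθ.emp_mem)).2.2.1⟩, fun x hx => ?_⟩
  · obtain ⟨b, hb, hxb⟩ := (hmem x).1 hx
    have hsb := hθ.succ_mem hb
    exact ⟨_, hstep _ hsb, mem_of_mem_of_le (h.1.mem (hFθ _ hsb)) hxb (hle b hb)⟩
  · obtain ⟨b, hb, hxb⟩ := (hmem x).1 hx
    have hsb := hθ.succ_mem hb
    have hx' : x ∊ F (ZFM.succ b) := mem_of_mem_of_le (h.1.mem (hFθ _ hsb)) hxb (hle b hb)
    exact ⟨_, mem_of_le_of_mem hdo (hle _ hsb) (hstep _ (hθ.succ_mem hsb)),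
      hmono _ _ _ (hFθ _ hsb) hx' (spec _ (hFθ _ hsb)).2.2.2.2⟩

theorem Club.exists_gt {D lam x : M} (hD : Club D lam) (hl : IsLimit lam) (hx : x ∊ lam) :
    ∃ y, y ∊ D ∧ x ∊ y ∧ y ∊ lam := by
  obtain ⟨y, hy, h⟩ := hD.1.2 _ (hl.succ_mem hx)
  have hyl := hD.1.1 hy
  exact ⟨y, hy, (succ_le (hl.1.mem hx) (hl.1.mem hyl)).1 h, hyl⟩

theorem Club.mem_of_forall {D lam d : M} (hD : Club D lam) (hd : d ∊ lam) (hdl : IsLimit d)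
    (h : ∀ x, x ∊ d → ∃ z, z ∊ D ∧ Le x z ∧ z ∊ d) : d ∊ D :=
  hD.2 d hd hdl ⟨fun _ hx => hx.2, fun x hx =>
    let ⟨z, hz, hxz, hzd⟩ := h x hx
    ⟨z, ⟨hz, hzd⟩, hxz⟩⟩

theorem Club.tail {lam b : M} (hl : IsLimit lam) (hb : b ∊ lam) :
    Club (sep lam fun x => b ∊ x) lam := by
  refine ⟨⟨fun x hx => (mem_sep.1 hx).1, fun x hx => ?_⟩, fun d hd hdl hc => ?_⟩
  · rcases (hl.1.mem hx).trichotomy (hl.1.mem hb) with h | rfl | h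
    · exact ⟨_, mem_sep.2 ⟨hl.succ_mem hb, mem_succ_self b⟩,
        Or.inl ((hl.1.mem hb).succ.trans h (mem_succ_self b))⟩
    · exact ⟨_, mem_sep.2 ⟨hl.succ_mem hb, mem_succ_self x⟩, Or.inl (mem_succ_self x)⟩
    · exact ⟨x, mem_sep.2 ⟨hx, h⟩, Le.refl x⟩
  · obtain ⟨y, hy⟩ := hdl.2.1
    obtain ⟨z, ⟨hz, hzd⟩, -⟩ := hc.2 y hy
    exact mem_sep.2 ⟨hd, hdl.1.trans (mem_sep.1 hz).2 hzd⟩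

/-- A closure point of "one step up in `A`, then one step up in `B`" is a limit of both clubs. -/
theorem Club.inter {lam k θ A B : M} (h : IsCof lam k) (hθ : IsLimit θ) (hk : θ ∊ k)
    (hA : Club A lam) (hB : Club B lam) : Club (sep lam fun x => x ∊ A ∧ x ∊ B) lam := by
  have hl := h.isLimit hθ hk
  refine ⟨⟨fun x hx => (mem_sep.1 hx).1, fun x hx => ?_⟩, fun d hd hdl hc => ?_⟩
  · obtain ⟨d, hd, hdl, hxd, H⟩ := h.exists_closure_point hθ hk
      (fun x y => ∃ z, z ∊ A ∧ x ∊ z ∧ z ∊ lam ∧ ∃ z', z' ∊ B ∧ z ∊ z' ∧ z' ∊ y) (by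
        intro x hx
        obtain ⟨z, hz, hxz, hzl⟩ := hA.exists_gt hl hx
        obtain ⟨z', hz', hzz', hzl'⟩ := hB.exists_gt hl hzl
        obtain ⟨y, hy, hzy⟩ := hl.2.2 _ hzl'
        exact ⟨y, hy, z, hz, hxz, hzl, z', hz', hzz', hzy⟩) (by
        rintro x x' y hx hx' ⟨z, hz, hxz, hzl, hz'⟩
        exact ⟨z, hz, (hl.1.mem hzl).trans hx' hxz, hzl, hz'⟩) hx (by
        rintro x y y' hy' hy ⟨z, hz, hxz, hzl, z', hz', hzz', hzy⟩
        exact ⟨z, hz, hxz, hzl, z', hz', hzz', (hl.1.mem hy').trans hzy hy⟩)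
    refine ⟨d, mem_sep.2 ⟨hd, hA.mem_of_forall hd hdl fun x hx => ?_,
      hB.mem_of_forall hd hdl fun x hx => ?_⟩, Or.inl hxd⟩
    · obtain ⟨y, hy, z, hz, hxz, hzl, z', hz', hzz', hzy⟩ := H x hx
      exact ⟨z, hz, Or.inl hxz, hdl.1.trans (hdl.1.mem hy |>.trans hzz' hzy) hy⟩
    · obtain ⟨y, hy, z, hz, hxz, hzl, z', hz', hzz', hzy⟩ := H x hx
      have hz'd := hdl.1.trans hzy hy
      exact ⟨z', hz', Or.inl ((hdl.1.mem hz'd).trans hxz hzz'), hz'd⟩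
  · refine mem_sep.2 ⟨hd, hA.mem_of_forall hd hdl fun x hx => ?_,
      hB.mem_of_forall hd hdl fun x hx => ?_⟩
    · obtain ⟨y, ⟨hy, hyd⟩, hxy⟩ := hc.2 x hx
      exact ⟨y, (mem_sep.1 hy).2.1, hxy, hyd⟩
    · obtain ⟨y, ⟨hy, hyd⟩, hxy⟩ := hc.2 x hx
      exact ⟨y, (mem_sep.1 hy).2.2, hxy, hyd⟩

/-- Above a given `x`, the least members of the clubs `D i` need no choice and have a common bound
since `m ∊ k`. Closure points of this operation are limits of every `D i`. -/
theorem Club.interFamily {lam k θ m : M} (h : IsCof lam k) (hθ : IsLimit θ) (hk : θ ∊ k)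
    (hm : m ∊ k) (D : M → M) [DfF fun v : ℕ → M => D (v 0)]
    (hD : ∀ i, i ∊ m → Club (D i) lam) :
    Club (sep lam fun x => ∀ i, i ∊ m → x ∊ D i) lam := by
  have hl := h.isLimit hθ hk
  refine ⟨⟨fun x hx => (mem_sep.1 hx).1, fun x hx => ?_⟩, fun d hd hdl hc => ?_⟩
  · obtain ⟨d, hd, hdl, hxd, H⟩ := h.exists_closure_point hθ hk
      (fun x y => ∀ i, i ∊ m → ∃ z, z ∊ D i ∧ x ∊ z ∧ z ∊ lam ∧ z ∊ y) (by
        intro x hx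
        have spec : ∀ i, i ∊ m → _ := fun i hi =>
          leastOrd_spec (P := fun z => z ∊ D i ∧ x ∊ z ∧ z ∊ lam) (by
            obtain ⟨z, hz⟩ := (hD i hi).exists_gt hl hx
            exact ⟨z, hl.1.mem hz.2.2, hz⟩)
        obtain ⟨y, hy, H⟩ := h.bound hm (fun i => leastOrd fun z => z ∊ D i ∧ x ∊ z ∧ z ∊ lam)
          fun i hi => (spec i hi).2.1.2.2
        exact ⟨y, hy, fun i hi => ⟨_, (spec i hi).2.1.1, (spec i hi).2.1.2.1,
          (spec i hi).2.1.2.2, H i hi⟩⟩) (by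
        intro x x' y hx hx' H i hi
        obtain ⟨z, hz, hxz, hzl, hzy⟩ := H i hi
        exact ⟨z, hz, (hl.1.mem hzl).trans hx' hxz, hzl, hzy⟩) hx (by
        intro x y y' hy' hy H i hi
        obtain ⟨z, hz, hxz, hzl, hzy⟩ := H i hi
        exact ⟨z, hz, hxz, hzl, (hl.1.mem hy').trans hzy hy⟩)
    refine ⟨d, mem_sep.2 ⟨hd, fun i hi => (hD i hi).mem_of_forall hd hdl fun x hx => ?_⟩,
      Or.inl hxd⟩
    obtain ⟨y, hy, H⟩ := H x hx
    obtain ⟨z, hz, hxz, hzl, hzy⟩ := H i hi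
    exact ⟨z, hz, Or.inl hxz, hdl.1.trans hzy hy⟩
  · refine mem_sep.2 ⟨hd, fun i hi => (hD i hi).mem_of_forall hd hdl fun x hx => ?_⟩
    obtain ⟨y, ⟨hy, hyd⟩, hxy⟩ := hc.2 x hx
    exact ⟨y, (mem_sep.1 hy).2 i hi, hxy, hyd⟩

/-- A shorter cofinal map into `d` would, by sending each value to the least `j` with that value
below `F j`, give a shorter cofinal map into θ, against regularity. -/
theorem isCof_of_strictMono {d θ : M} (hθ : IsInfRegular θ) (F : M → M)
    [DfF fun v : ℕ → M => F (v 0)] (hF : ∀ i j, i ∊ j → j ∊ θ → F i ∊ F j) (hd : IsOrd d)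
    (h1 : ∀ i, i ∊ θ → F i ∊ d) (h2 : ∀ x, x ∊ d → ∃ i, i ∊ θ ∧ x ∊ F i) : IsCof d θ := by
  refine ⟨hd, hθ.1.1, ⟨graph F θ, funTo_graph (fun _ => Iff.rfl) h1, ?_, fun x hx => ?_⟩, ?_⟩
  · rintro y ⟨i, hi⟩
    obtain ⟨hiθ, rfl⟩ := app_graph.1 hi
    exact h1 i hiθ
  · obtain ⟨i, hi, hx⟩ := h2 x hx
    exact ⟨F i, ⟨i, app_graph.2 ⟨hi, rfl⟩⟩, Or.inl hx⟩
  · rintro m hm ⟨f, ⟨hf, hfd⟩, hfc⟩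
    have spec : ∀ i, i ∊ m → _ := fun i hi =>
      leastOrd_spec (P := fun j => j ∊ θ ∧ ap f i ∊ F j) (by
        obtain ⟨j, hj⟩ := h2 _ (hfd _ _ (hf.app hi))
        exact ⟨j, hθ.1.1.mem hj.1, hj⟩)
    obtain ⟨b, hb, H⟩ := hθ.2.bound hm (fun i => leastOrd fun j => j ∊ θ ∧ ap f i ∊ F j)
      fun i hi => (spec i hi).2.1.1
    obtain ⟨y, ⟨i, hi⟩, hy⟩ := hfc.2 _ (h1 b hb)
    have him : i ∊ m := hf.mem hi
    rw [hf.app_iff him] at hi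
    subst hi
    have hFb : F (leastOrd fun j => j ∊ θ ∧ ap f i ∊ F j) ∊ F b := hF _ _ (H i him) hb
    have ho : IsOrd (ap f i) := hd.mem (hfd _ _ (hf.app him))
    exact hy.not_mem ((hd.mem (h1 b hb)).trans (spec i him).2.1.2 hFb)

/-- Every member of a set of ordinals of order type `r` is its `n`-th member for some `n < r`. -/
theorem exists_isNth {x r e d : M} (hd : IsOrd d) (hx : Sub x d) (hr : OrderType (ext x) r)
    (he : e ∊ x) : ∃ n, n ∊ r ∧ IsNth x n e := by
  obtain ⟨hro, f, ⟨⟨hf, hfr⟩, hsurj, hinj⟩, hmono⟩ := hr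
  have hfe := hf.app (show e ∈ ext x from he)
  have hn : ap f e ∊ r := hfr _ _ hfe
  -- The index of `e` is its image under the order isomorphism, whose restriction to the members
  -- below `e` is the isomorphism required.
  refine ⟨ap f e, hn, he, hro.mem hn, graph (ap f) (sep x fun y => y ∊ e), ⟨?_, ?_, ?_⟩, ?_⟩
  · refine funTo_graph (fun y => (mem_sep (P := fun y => y ∊ e)).symm) fun y hy => ?_
    rw [mem_sep] at hy
    exact hmono _ _ _ _ (hf.app hy.1) hfe hy.2
  · intro i hi
    obtain ⟨y, hy⟩ := hsurj i (hro.trans hi hn)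
    have hyx : y ∊ x := hf.mem hy
    refine ⟨y, app_graph.2 ⟨mem_sep.2 ⟨hyx, ?_⟩, (hf.app_iff hyx).1 hy⟩⟩
    rcases (hd.mem (hx y hyx)).trichotomy (hd.mem (hx e he)) with h | rfl | h
    · exact h
    · rw [hf.app_iff hyx] at hy
      exact absurd (hy ▸ hi) (mem_irrefl _)
    · exact absurd (hmono _ _ _ _ hfe hy h) fun h' => mem_asymm h' hi
  · intro y y' i hy hy'
    rw [app_graph, mem_sep] at hy hy'
    exact hinj y y' i ((hf.app_iff hy.1.1).2 hy.2) ((hf.app_iff hy'.1.1).2 hy'.2)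
  · intro y y' i j hy hy' hlt
    rw [app_graph, mem_sep] at hy hy'
    exact hmono y y' i j ((hf.app_iff hy.1.1).2 hy.2) ((hf.app_iff hy'.1.1).2 hy'.2) hlt

end Cofinality

section Stationarity

variable {M : Type*} [setLang.Structure M] [hM : ZFModel M]

/-! ### Dependent choice -/

noncomputable def prod (a b : M) : M := sUnion (img a fun x => img b fun y => pr x y)

theorem mem_prod {a b x y : M} : pr x y ∊ prod a b ↔ x ∊ a ∧ y ∊ b := by
  rw [prod, mem_sUnion]
  constructor
  · rintro ⟨z, hz, h⟩
    obtain ⟨x', hx', rfl⟩ := mem_img.1 hz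
    obtain ⟨y', hy', e⟩ := mem_img.1 h
    obtain ⟨rfl, rfl⟩ := pr_inj e
    exact ⟨hx', hy'⟩
  · rintro ⟨hx, hy⟩
    exact ⟨_, mem_img.2 ⟨x, hx, rfl⟩, mem_img.2 ⟨y, hy, rfl⟩⟩

theorem FunTo.sub_prod {f d k X : M} (hf : FunTo f (ext d) (ext X)) (hd : Sub d k) :
    Sub f (prod k X) := by
  intro p hp
  obtain ⟨x, y, e, hx⟩ := hf.1.1 p hp
  rw [isPair_iff] at e
  subst e
  exact mem_prod.2 ⟨hd _ hx, hf.2 _ _ (app_iff.2 hp)⟩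

instance : Df fun v : ℕ → M => FunTo (v 0) (ext (v 1)) (ext (v 2)) := by
  change Df fun v : ℕ → M => FunOn (v 0) (ext (v 1)) ∧ ∀ x y : M, App (v 0) x y → y ∊ v 2
  infer_instance

/-- Dependent choice of length `θ` for sequences any two of whose terms are related by `Q`. -/
theorem DC.exists_seq {θ X : M} (hθ : IsLimit θ) (hDC : DC θ) (Q : M → M → Prop)
    [Df fun v : ℕ → M => Q (v 0) (v 1)]
    (H : ∀ d, d ∊ θ → ∀ f, FunTo f (ext d) (ext X) →
      (∀ i j, i ∊ j → j ∊ d → Q (ap f i) (ap f j)) →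
      ∃ y, y ∊ X ∧ ∀ i, i ∊ d → Q (ap f i) y) :
    ∃ f, FunTo f (ext θ) (ext X) ∧ ∀ i j, i ∊ j → j ∊ θ → Q (ap f i) (ap f j) := by
  have hdf : Df fun v : ℕ → M => FunTo (v 1) (ext (v 0)) (ext X) :=
    Df.comp₃ (P := fun x y z : M => FunTo x (ext y) (ext z))
  -- The tree of all `Q`-chains in `X` of length less than θ. The union of a maximal branch is the
  -- function `G` on the ordinal `W` below.
  let T : M := sep (pow (prod θ X)) fun f => ∃ d, d ∊ θ ∧ FunTo f (ext d) (ext X) ∧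
    ∀ i j, i ∊ j → j ∊ d → Q (ap f i) (ap f j)
  have memT : ∀ f, f ∊ T ↔ ∃ d, d ∊ θ ∧ FunTo f (ext d) (ext X) ∧
      ∀ i j, i ∊ j → j ∊ d → Q (ap f i) (ap f j) := by
    intro f
    refine mem_sep.trans ⟨fun h => h.2, fun h => ⟨?_, h⟩⟩
    obtain ⟨d, hd, hf, -⟩ := h
    exact mem_pow.2 (hf.sub_prod (hθ.1.1 d hd))
  have hT : IsTree T θ X := by
    intro f hf
    obtain ⟨d, hd, hf, hQ⟩ := (memT f).1 hf
    have hdo := hθ.1.mem hd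
    refine ⟨d, hd, hf, fun a ha => ⟨graph (ap f) a, (memT _).2 ⟨a, hθ.1.trans ha hd, ?_, ?_⟩,
      fun p => ⟨fun hp => ?_, ?_⟩⟩⟩
    · exact funTo_graph (fun _ => Iff.rfl) fun x hx => hf.2 _ _ (hf.1.app (hdo.trans hx ha))
    · intro i j hij hj
      rw [ap_graph hj, ap_graph ((hdo.mem ha).trans hij hj)]
      exact hQ i j hij (hdo.trans hj ha)
    · obtain ⟨x, hx, rfl⟩ := mem_graph.1 hp
      exact ⟨app_iff.1 (hf.1.app (hdo.trans hx ha)), x, _, isPair_iff.2 rfl, hx⟩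
    · rintro ⟨hp, x, y, e, hx⟩
      rw [isPair_iff] at e
      subst e
      rw [← app_iff, hf.1.app_iff (hdo.trans hx ha)] at hp
      exact mem_graph.2 ⟨x, hx, by rw [hp]⟩
  obtain ⟨b, ⟨hbT, hbc⟩, hmax⟩ := hDC X T hT
  have huniq : ∀ f g, f ∊ b → g ∊ b → ∀ i y y', App f i y → App g i y' → y = y' := by
    have key : ∀ f g, f ∊ b → g ∊ b → Sub f g → ∀ i y y', App f i y → App g i y' → y = y' := by
      intro f g hf hg hfg i y y' hy hy'
      obtain ⟨d, hd, hgF, -⟩ := (memT g).1 (hbT g hg)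
      exact (hgF.1.2 i (hgF.1.mem hy')).unique (app_iff.2 (hfg _ (app_iff.1 hy))) hy'
    intro f g hf hg i y y' hy hy'
    rcases hbc f g hf hg with h | h
    · exact key f g hf hg h i y y' hy hy'
    · exact (key g f hg hf h i y' y hy' hy).symm
  let W : M := sep θ fun i => ∃ f, f ∊ b ∧ ∃ y, App f i y
  let G : M → M := fun i => the fun y => ∃ f, f ∊ b ∧ App f i y
  have hG : DfF fun v : ℕ → M => G (v 0) :=
    inferInstanceAs (DfF fun v : ℕ → M => the fun y => ∃ f, f ∊ b ∧ App f (v 0) y)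
  have Geq : ∀ f i y, f ∊ b → App f i y → G i = y := fun f i y hf hy =>
    the_eq ⟨f, hf, hy⟩ fun z ⟨g, hg, hz⟩ => huniq g f hg hf i z y hz hy
  have memW : ∀ i, i ∊ W ↔ ∃ f d, f ∊ b ∧ d ∊ θ ∧ FunTo f (ext d) (ext X) ∧
      (∀ i j, i ∊ j → j ∊ d → Q (ap f i) (ap f j)) ∧ i ∊ d := by
    intro i
    refine mem_sep.trans ⟨?_, ?_⟩
    · rintro ⟨-, f, hf, y, hy⟩
      obtain ⟨d, hd, hfF, hfQ⟩ := (memT f).1 (hbT f hf)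
      exact ⟨f, d, hf, hd, hfF, hfQ, hfF.1.mem hy⟩
    · rintro ⟨f, d, hf, hd, hfF, hfQ, hi⟩
      exact ⟨hθ.1.trans hi hd, f, hf, _, hfF.1.app hi⟩
  have hGX : ∀ i, i ∊ W → G i ∊ X := by
    intro i hi
    obtain ⟨f, d, hf, hd, hfF, hfQ, hi⟩ := (memW i).1 hi
    rw [Geq f i _ hf (hfF.1.app hi)]
    exact hfF.2 _ _ (hfF.1.app hi)
  have hGQ : ∀ i j, i ∊ j → j ∊ W → Q (G i) (G j) := by
    intro i j hij hj
    obtain ⟨f, d, hf, hd, hfF, hfQ, hj⟩ := (memW j).1 hj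
    have hi := (hθ.1.mem hd).trans hij hj
    rw [Geq f j _ hf (hfF.1.app hj), Geq f i _ hf (hfF.1.app hi)]
    exact hfQ i j hij hj
  have hWo : IsOrd W := by
    refine ⟨fun x hx z hz => ?_, fun x hx => ?_⟩
    · obtain ⟨f, d, hf, hd, hfF, hfQ, hx⟩ := (memW x).1 hx
      exact (memW z).2 ⟨f, d, hf, hd, hfF, hfQ, (hθ.1.mem hd).trans hz hx⟩
    · exact hθ.1.2 x (mem_sep.1 hx).1
  -- Either the union of the branch has length `W < θ`, and `H` would extend it by one value, or it
  -- already has length θ.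
  rcases (hWo.le_iff_sub hθ.1).2 fun x hx => (mem_sep.1 hx).1 with hW | hW
  · exfalso
    obtain ⟨y, hy, hyQ⟩ := H W hW (graph G W) (funTo_graph (fun _ => Iff.rfl) hGX) (by
      intro i j hij hj
      rw [ap_graph hj, ap_graph (hWo.trans hij hj)]
      exact hGQ i j hij hj)
    let G' : M → M := fun i => the fun z => (i ∊ W ∧ z = G i) ∨ (¬ i ∊ W ∧ z = y)
    have hG' : DfF fun v : ℕ → M => G' (v 0) := inferInstanceAs (DfF fun v : ℕ → M =>
      the fun z => (v 0 ∊ W ∧ z = G (v 0)) ∨ (¬ v 0 ∊ W ∧ z = y))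
    have e1 : ∀ i, i ∊ W → G' i = G i := fun i hi => the_eq (Or.inl ⟨hi, rfl⟩) (by tauto)
    have e2 : G' W = y := the_eq (Or.inr ⟨mem_irrefl W, rfl⟩) (by
      have := mem_irrefl W
      tauto)
    have hf'T : graph G' (succ W) ∊ T := by
      refine (memT _).2 ⟨succ W, hθ.succ_mem hW, funTo_graph (fun _ => Iff.rfl) fun i hi => ?_, ?_⟩
      · rcases mem_succ.1 hi with hi | rfl
        · rw [e1 i hi]; exact hGX i hi
        · rw [e2]; exact hy
      · intro i j hij hj
        rw [ap_graph hj, ap_graph (hWo.succ.trans hij hj)]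
        rcases mem_succ.1 hj with hj | rfl
        · rw [e1 j hj, e1 i (hWo.trans hij hj)]
          exact hGQ i j hij hj
        · rw [e1 i hij, e2]
          have := hyQ i hij
          rwa [ap_graph hij] at this
    have hsub : ∀ f, f ∊ b → Sub f (graph G' (succ W)) := by
      intro f hf p hp
      obtain ⟨d, hd, hfF, hfQ⟩ := (memT f).1 (hbT f hf)
      obtain ⟨x, z, e, hx⟩ := hfF.1.1 p hp
      rw [isPair_iff] at e
      subst e
      rw [← app_iff] at hp
      have hxW : x ∊ W := (memW x).2 ⟨f, d, hf, hd, hfF, hfQ, hx⟩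
      exact mem_graph.2 ⟨x, mem_succ.2 (Or.inl hxW), by rw [e1 x hxW, Geq f x z hf hp]⟩
    -- Adjoining the extended chain leaves a branch, so by maximality it was in `b` already; but its
    -- domain contains `W`, which would give `W ∊ W`.
    have hb' := hmax (sep T fun f => f ∊ b ∨ f = graph G' (succ W))
      ⟨fun f hf => (mem_sep.1 hf).1, fun f g hf hg => by
        rcases (mem_sep.1 hf).2 with hf | rfl
        · rcases (mem_sep.1 hg).2 with hg | rfl
          · exact hbc f g hf hg
          · exact Or.inl (hsub f hf)
        · rcases (mem_sep.1 hg).2 with hg | rfl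
          · exact Or.inr (hsub g hg)
          · exact Or.inl fun _ h => h⟩
      fun f hf => mem_sep.2 ⟨hbT f hf, Or.inl hf⟩
    have hf'b : graph G' (succ W) ∊ b := hb' ▸ mem_sep.2 ⟨hf'T, Or.inr rfl⟩
    exact mem_irrefl W (mem_sep.2 ⟨hW, _, hf'b, _, app_graph.2 ⟨mem_succ_self W, rfl⟩⟩)
  · refine ⟨graph G θ, funTo_graph (fun _ => Iff.rfl) fun i hi => hGX i (hW.symm ▸ hi), ?_⟩
    intro i j hij hj
    rw [ap_graph hj, ap_graph (hθ.1.trans hij hj)]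
    exact hGQ i j hij (hW.symm ▸ hj)

/-! ### Stationary sets given by ladder systems -/

instance : Df fun v : ℕ → M => OrderType (ext (v 0)) (v 1) := by
  change Df fun v : ℕ → M => IsOrd (v 1) ∧ ∃ f : M,
    ((FunOn f (ext (v 0)) ∧ ∀ x y : M, App f x y → y ∊ v 1) ∧
      (∀ y, y ∊ v 1 → ∃ x : M, App f x y) ∧ ∀ x x' y : M, App f x y → App f x' y → x = x') ∧
    ∀ x y i j : M, App f x i → App f y j → x ∊ y → i ∊ j
  have : Df fun v : ℕ → M => FunOn (v 0) (ext (v 1)) :=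
    Df.comp₂ (P := fun x y => FunOn x (ext y))
  infer_instance

theorem isNth_iff {x i a : M} :
    IsNth x i a ↔ a ∊ x ∧ OrderType (ext (sep x fun y => y ∊ a)) i := by
  have : ext x ∩ ext a = ext (sep x fun y => y ∊ a) :=
    Set.ext fun y => (mem_sep (P := fun y => y ∊ a)).symm
  rw [IsNth, this]

instance : Df fun v : ℕ → M => IsNth (v 0) (v 1) (v 2) := by
  have : Df fun v : ℕ → M => OrderType (ext (sep (v 0) fun y => y ∊ v 2)) (v 1) :=
    Df.comp₂ (P := fun x y => OrderType (ext x) y) (s := fun v => sep (v 0) fun y => y ∊ v 2)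
  exact Df.congr (P := fun v => v 2 ∊ v 0 ∧ OrderType (ext (sep (v 0) fun y => y ∊ v 2)) (v 1))
    inferInstance fun v => isNth_iff

/-- `d` belongs to `LadderS R n a b`. -/
def InLadderS (R : M → M → Prop) (n a b d : M) : Prop := d ∈ LadderS R n a b

/-- `LadderS R n a b ∩ xi` is stationary in `xi`. -/
def StatIn (R : M → M → Prop) (n a b xi : M) : Prop :=
  ∀ D : M, Club D xi → ∃ d : M, d ∊ D ∧ d ∊ xi ∧ InLadderS R n a b d

section

variable {R : M → M → Prop} [hR : Df fun v : ℕ → M => R (v 0) (v 1)]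

instance : Df fun v : ℕ → M => InLadderS R (v 0) (v 1) (v 2) (v 3) := by
  change Df fun v : ℕ → M => ∃ x : M, R (v 3) x ∧ (∃ r : M, OrderType (ext x) r ∧ v 0 ∊ r) ∧
    ∃ e : M, IsNth x (v 0) e ∧ Le (v 1) e ∧ e ∊ v 2
  have : Df fun v : ℕ → M => OrderType (ext (v 1)) (v 0) :=
    Df.comp₂ (P := fun x y => OrderType (ext x) y)
  infer_instance

instance : Df fun v : ℕ → M => StatIn R (v 0) (v 1) (v 2) (v 3) := by
  unfold StatIn
  infer_instance

theorem InLadderS.mono {n a b a' b' d : M} (h : InLadderS R n a b d) (hb' : IsOrd b')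
    (ha : Le a' a) (hb : Le b b') : InLadderS R n a' b' d := by
  obtain ⟨x, h1, h2, e, h3, h4, h5⟩ := h
  have h6 := mem_of_mem_of_le hb' h5 hb
  exact ⟨x, h1, h2, e, h3, ha.trans (hb'.mem h6) h4, h6⟩

theorem StatIn.mono {n a b a' b' xi : M} (h : StatIn R n a b xi) (hb' : IsOrd b')
    (ha : Le a' a) (hb : Le b b') : StatIn R n a' b' xi := fun D hD =>
  let ⟨d, h1, h2, h3⟩ := h D hD
  ⟨d, h1, h2, h3.mono hb' ha hb⟩

/-- The only use of AC_γ: one club is chosen for each `n`, and `γ ∊ k` makes the intersection a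
club. -/
theorem exists_club_of_forall_not_statIn {θ γ lam k a b : M} (hθ : IsLimit θ) (hγ : IsOrd γ)
    (hθγ : Le θ γ) (hAC : AC γ) (hlam : IsCof lam k) (hγk : γ ∊ k)
    (H : ∀ n, n ∊ γ → ¬ StatIn R n a b lam) :
    ∃ D, Club D lam ∧ ∀ n, n ∊ γ → ∀ d, d ∊ D → ¬ InLadderS R n a b d := by
  have hθk : θ ∊ k := mem_of_le_of_mem hlam.2.1 hθγ hγk
  let F : M → M := fun n =>
    sep (pow lam) fun D => Club D lam ∧ ∀ d, d ∊ D → ¬ InLadderS R n a b d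
  have hF : DfF fun v : ℕ → M => F (v 0) := inferInstanceAs (DfF fun v : ℕ → M =>
    sep (pow lam) fun D => Club D lam ∧ ∀ d, d ∊ D → ¬ InLadderS R (v 0) a b d)
  obtain ⟨f, hf, hfF⟩ := hAC (graph F γ) (funOn_graph fun _ => Iff.rfl) (by
    intro n X hn
    obtain ⟨hnγ, rfl⟩ := app_graph.1 hn
    have := H n hnγ
    simp only [StatIn, not_forall, not_exists, not_and] at this
    obtain ⟨D, hD, hDn⟩ := this
    exact ⟨D, mem_sep.2 ⟨mem_pow.2 hD.1.1, hD, fun d hd => hDn d hd (hD.1.1 hd)⟩⟩)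
  have hfs : ∀ n, n ∊ γ → Club (ap f n) lam ∧ ∀ d, d ∊ ap f n → ¬ InLadderS R n a b d := by
    intro n hn
    have := hfF n (F n) (ap f n) (app_graph.2 ⟨hn, rfl⟩) (hf.app hn)
    exact (mem_sep.1 this).2
  refine ⟨_, Club.interFamily hlam hθ hθk hγk (ap f) fun i hi => (hfs i hi).1, ?_⟩
  intro n hn d hd
  exact (hfs n hn).2 d ((mem_sep.1 hd).2 n hn)

/-- The core of both parts. The ordinal `lam` and the club are arbitrary and `R` may have indices
beyond `lam`, so the same lemma serves every ξ in the second part. -/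
theorem exists_statIn {θ γ lam k E : M} (hθ : IsInfRegular θ) (hDC : DC θ) (hγ : IsOrd γ)
    (hθγ : Le θ γ) (hAC : AC γ) (hlam : IsCof lam k) (hγk : γ ∊ k) (hE : Club E lam)
    (hRE : ∀ d, d ∊ lam → IsCof d θ → d ∊ E →
      ∃ x, R d x ∧ Cofinal (ext x) d ∧ ∃ r, OrderType (ext x) r ∧ Le r γ) :
    ∃ n, n ∊ γ ∧ ∀ a, a ∊ lam → ∃ b, a ∊ b ∧ b ∊ lam ∧ StatIn R n a b lam := by
  by_contra H
  push Not at H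
  have hθk : θ ∊ k := mem_of_le_of_mem hlam.2.1 hθγ hγk
  have hl := hlam.isLimit hθ.1 hθk
  have spec : ∀ n, n ∊ γ → _ := fun n hn =>
    leastOrd_spec (P := fun a => a ∊ lam ∧ ∀ b, a ∊ b → b ∊ lam → ¬ StatIn R n a b lam) (by
      obtain ⟨a, ha⟩ := H n hn
      exact ⟨a, hl.1.mem ha.1, ha⟩)
  -- Nonstationarity persists when the lower endpoint grows, so one α above all the least failure
  -- points works for every `n`.
  obtain ⟨α, hα, hαb⟩ := hlam.bound hγk
    (fun n => leastOrd fun a => a ∊ lam ∧ ∀ b, a ∊ b → b ∊ lam → ¬ StatIn R n a b lam)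
    fun n hn => (spec n hn).2.1.1
  have hα' : ∀ n, n ∊ γ → ∀ b, α ∊ b → b ∊ lam → ¬ StatIn R n α b lam := by
    intro n hn b hb hbl hst
    exact (spec n hn).2.1.2 b ((hl.1.mem hbl).trans (hαb n hn) hb) hbl
      (hst.mono (hl.1.mem hbl) (Or.inl (hαb n hn)) (Le.refl b))
  let mn : M → M := fun D => leastOrd fun x => x ∊ D
  have hmn : DfF fun v : ℕ → M => mn (v 0) :=
    inferInstanceAs (DfF fun v : ℕ → M => leastOrd fun x => x ∊ v 0)
  have mn_mem : ∀ D, Club D lam → mn D ∊ D := fun D hD =>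
    (leastOrd_spec (P := fun x => x ∊ D) (by
      obtain ⟨x, hx⟩ := hl.2.1
      obtain ⟨y, hy, -⟩ := hD.1.2 x hx
      exact ⟨y, hl.1.mem (hD.1.1 hy), hy⟩)).2.1
  let X : M := sep (pow lam) fun D => Club D lam ∧ Sub D E ∧ ∀ x, x ∊ D → α ∊ x
  have memX : ∀ D, D ∊ X ↔ Club D lam ∧ Sub D E ∧ ∀ x, x ∊ D → α ∊ x := fun D =>
    mem_sep.trans ⟨fun h => h.2, fun h => ⟨mem_pow.2 h.1.1.1, h⟩⟩
  -- A later club shrinks the earlier one, has a larger minimum, and avoids every S^n_{α,μ}, where μ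
  -- is the earlier minimum.
  obtain ⟨G, hG, hGQ⟩ := hDC.exists_seq (X := X) hθ.1 (fun D D' => Sub D' D ∧ mn D ∊ mn D' ∧
      ∀ n, n ∊ γ → ∀ x, x ∊ D' → ¬ InLadderS R n α (mn D) x) (by
    intro d hd f hf hfQ
    have hdk := hlam.2.1.trans hd hθk
    have hfX : ∀ i, i ∊ d → Club (ap f i) lam ∧ Sub (ap f i) E ∧ ∀ x, x ∊ ap f i → α ∊ x :=
      fun i hi => (memX _).1 (hf.2 _ _ (hf.1.app hi))
    -- One β exceeds α and all earlier minima. By monotonicity, a club avoiding the sets for β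
    -- avoids those for all earlier minima; cutting it above β also raises the minimum.
    obtain ⟨β₀, hβ₀, hb⟩ := hlam.bound hdk (fun i => mn (ap f i)) fun i hi =>
      (hfX i hi).1.1.1 (mn_mem _ (hfX i hi).1)
    obtain ⟨β, hβ, hβ₀β, hβl⟩ := (Club.tail hl hα).exists_gt hl hβ₀
    have hαβ : α ∊ β := (mem_sep.1 hβ).2
    have hβo := hl.1.mem hβl
    obtain ⟨D₀, hD₀, hD₀S⟩ := exists_club_of_forall_not_statIn hθ.1 hγ hθγ hAC hlam hγk
      fun n hn => hα' n hn β hαβ hβl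
    have c1 := Club.interFamily hlam hθ.1 hθk hdk (ap f) fun i hi => (hfX i hi).1
    have c2 := Club.inter hlam hθ.1 hθk c1 hE
    have c3 := Club.inter hlam hθ.1 hθk c2 (Club.tail hl hβl)
    have c4 := Club.inter hlam hθ.1 hθk c3 hD₀
    generalize hD : sep lam _ = D at c4
    have memD : ∀ x, x ∊ D → (∀ i, i ∊ d → x ∊ ap f i) ∧ x ∊ E ∧ β ∊ x ∧ x ∊ D₀ := by
      intro x hx
      rw [← hD] at hx
      obtain ⟨h3, h0⟩ := (mem_sep.1 hx).2
      obtain ⟨h2, hβx⟩ := (mem_sep.1 h3).2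
      obtain ⟨h1, hxE⟩ := (mem_sep.1 h2).2
      exact ⟨(mem_sep.1 h1).2, hxE, (mem_sep.1 hβx).2, h0⟩
    refine ⟨D, (memX D).2 ⟨c4, fun x hx => (memD x hx).2.1, fun x hx => ?_⟩, fun i hi =>
      ⟨fun x hx => (memD x hx).1 i hi, ?_, fun n hn x hx hS => ?_⟩⟩
    · exact (hl.1.mem (c4.1.1 hx)).trans hαβ (memD x hx).2.2.1
    · have hm := mn_mem D c4
      exact (hl.1.mem (c4.1.1 hm)).trans (hβo.trans (hb i hi) hβ₀β) (memD _ hm).2.2.1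
    · exact hD₀S n hn x (memD x hx).2.2.2
        (hS.mono hβo (Le.refl α) (Or.inl (hβo.trans (hb i hi) hβ₀β))))
  have hGX : ∀ i, i ∊ θ → Club (ap G i) lam ∧ Sub (ap G i) E ∧ ∀ x, x ∊ ap G i → α ∊ x :=
    fun i hi => (memX _).1 (hG.2 _ _ (hG.1.app hi))
  have hmG : ∀ i, i ∊ θ → mn (ap G i) ∊ ap G i := fun i hi => mn_mem _ (hGX i hi).1
  have hml : ∀ i, i ∊ θ → mn (ap G i) ∊ lam := fun i hi => (hGX i hi).1.1.1 (hmG i hi)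
  have hlt : ∀ i j, i ∊ j → j ∊ θ → mn (ap G i) ∊ mn (ap G j) :=
    fun i j hij hj => (hGQ i j hij hj).2.1
  let δ : M := sUnion (img θ fun i => mn (ap G i))
  have memδ : ∀ x, x ∊ δ ↔ ∃ i, i ∊ θ ∧ x ∊ mn (ap G i) := by
    intro x
    refine mem_sUnion.trans ⟨?_, ?_⟩
    · rintro ⟨y, hy, hx⟩
      obtain ⟨i, hi, rfl⟩ := mem_img.1 hy
      exact ⟨i, hi, hx⟩
    · rintro ⟨i, hi, hx⟩
      exact ⟨_, mem_img.2 ⟨i, hi, rfl⟩, hx⟩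
  have hδo : IsOrd δ := isOrd_sUnion fun x hx => by
    obtain ⟨i, hi, rfl⟩ := mem_img.1 hx
    exact hl.1.mem (hml i hi)
  have hmδ : ∀ i, i ∊ θ → mn (ap G i) ∊ δ := fun i hi =>
    (memδ _).2 ⟨_, hθ.1.succ_mem hi, hlt _ _ (mem_succ_self i) (hθ.1.succ_mem hi)⟩
  have hδl : δ ∊ lam := by
    obtain ⟨x, hx, hb⟩ := hlam.bound hθk (fun i => mn (ap G i)) hml
    refine mem_of_le_of_mem hl.1 ((hδo.le_iff_sub (hl.1.mem hx)).2 fun z hz => ?_) hx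
    obtain ⟨i, hi, hz⟩ := (memδ z).1 hz
    exact (hl.1.mem hx).trans hz (hb i hi)
  have hcofδ : IsCof δ θ := isCof_of_strictMono hθ (fun i => mn (ap G i)) hlt hδo hmδ
    fun x hx => (memδ x).1 hx
  have hδlim : IsLimit δ := by
    refine ⟨hδo, ⟨_, hmδ _ hθ.1.emp_mem⟩, fun x hx => ?_⟩
    obtain ⟨i, hi, hx⟩ := (memδ x).1 hx
    exact ⟨_, hmδ i hi, hx⟩
  -- The clubs decrease, so all minima from stage `i` on lie in the `i`-th club, and δ is their
  -- limit.
  have hδG : ∀ i, i ∊ θ → δ ∊ ap G i := by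
    intro i hi
    refine (hGX i hi).1.mem_of_forall hδl hδlim fun x hx => ?_
    obtain ⟨j, hj, hx⟩ := (memδ x).1 hx
    rcases (hθ.1.1.mem hi).trichotomy (hθ.1.1.mem hj) with h | rfl | h
    · exact ⟨_, (hGQ i j h hj).1 _ (hmG j hj), Or.inl hx, hmδ j hj⟩
    · exact ⟨_, hmG i hi, Or.inl hx, hmδ i hi⟩
    · exact ⟨_, hmG i hi, Or.inl ((hl.1.mem (hml i hi)).trans hx (hlt j i h hi)), hmδ i hi⟩
  obtain ⟨x, hRx, hxc, r, hr, hrγ⟩ :=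
    hRE δ hδl hcofδ ((hGX _ hθ.1.emp_mem).2.1 _ (hδG _ hθ.1.emp_mem))
  -- Since α is below δ, the cofinal ladder at δ has a member in [α, δ), and that member lies below
  -- some minimum.
  obtain ⟨e, he, hαe⟩ := hxc.2 α ((hGX _ hθ.1.emp_mem).2.2 _ (hδG _ hθ.1.emp_mem))
  obtain ⟨i, hi, hei⟩ := (memδ e).1 (hxc.1 he)
  obtain ⟨n, hn, hnth⟩ := exists_isNth hδo hxc.1 hr he
  have hnγ : n ∊ γ := mem_of_mem_of_le hγ hn hrγ
  have hsi := hθ.1.succ_mem hi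
  exact (hGQ i _ (mem_succ_self i) hsi).2.2 n hnγ δ (hδG _ hsi)
    ⟨x, hRx, ⟨r, hr, hn⟩, e, hnth, hαe, hei⟩

end

end Stationarity

section Hartogs

variable {M : Type*} [setLang.Structure M] [hM : ZFModel M]

/-! ### Uniqueness of order types -/

/-- This is the Mostowski collapse equation for an order isomorphism. It determines the values by
induction, whence `OrderType.unique`. -/
theorem mem_ap_of_bij {x r f a z : M} (hx : ∀ y, y ∊ x → IsOrd y) (hr : IsOrd r)
    (hf : Bij f (ext x) (ext r))
    (hmono : ∀ y y' i j : M, App f y i → App f y' j → y ∊ y' → i ∊ j) (ha : a ∊ x) :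
    z ∊ ap f a ↔ ∃ b, b ∊ x ∧ b ∊ a ∧ z = ap f b := by
  obtain ⟨⟨hf, hfr⟩, hsurj, hinj⟩ := hf
  have hfa := hf.app (show a ∈ ext x from ha)
  constructor
  · intro hz
    obtain ⟨b, hb⟩ := hsurj z (hr.trans hz (hfr _ _ hfa))
    have hbx : b ∊ x := hf.mem hb
    have e := (hf.app_iff hbx).1 hb
    refine ⟨b, hbx, ?_, e⟩
    rcases (hx b hbx).trichotomy (hx a ha) with h | rfl | h
    · exact h
    · exact absurd (e ▸ hz) (mem_irrefl _)
    · exact absurd (hmono _ _ _ _ hfa hb h) fun h' => mem_asymm h' hz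
  · rintro ⟨b, hbx, hba, rfl⟩
    exact hmono _ _ _ _ (hf.app hbx) hfa hba

theorem OrderType.unique {x r r' : M} (hx : ∀ y, y ∊ x → IsOrd y) (h : OrderType (ext x) r)
    (h' : OrderType (ext x) r') : r = r' := by
  obtain ⟨hr, f, hf, hmono⟩ := h
  obtain ⟨hr', f', hf', hmono'⟩ := h'
  have key : ∀ a, IsOrd a → a ∊ x → ap f a = ap f' a := by
    refine IsOrd.induct (fun a => a ∊ x → ap f a = ap f' a) fun a ha ih hax => ?_
    refine ext_of fun z => ?_
    rw [mem_ap_of_bij hx hr hf hmono hax, mem_ap_of_bij hx hr' hf' hmono' hax]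
    refine exists_congr fun b => and_congr_right fun hb => and_congr_right fun hba => ?_
    rw [ih b hba hb]
  refine ext_of fun z => ⟨fun hz => ?_, fun hz => ?_⟩
  · obtain ⟨a, ha⟩ := hf.2.1 z hz
    have hax : a ∊ x := hf.1.1.mem ha
    rw [(hf.1.1.app_iff hax).1 ha, key a (hx a hax) hax]
    exact hf'.1.2 _ _ (hf'.1.1.app hax)
  · obtain ⟨a, ha⟩ := hf'.2.1 z hz
    have hax : a ∊ x := hf'.1.1.mem ha
    rw [(hf'.1.1.app_iff hax).1 ha, ← key a (hx a hax) hax]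
    exact hf.1.2 _ _ (hf.1.1.app hax)

theorem IsNth.unique {x n e e' : M} (hx : ∀ y, y ∊ x → IsOrd y) (h : IsNth x n e)
    (h' : IsNth x n e') : e = e' := by
  have key : ∀ e e', IsNth x n e → IsNth x n e' → ¬ e ∊ e' := by
    intro e e' h h' hlt
    rw [isNth_iff] at h h'
    have he'o := hx _ h'.1
    -- Inside the part of `x` below `e'`, of order type `n`, the member `e` has an index `i < n`;
    -- but that part cut at `e` is the part of `x` below `e`, again of order type `n`.
    obtain ⟨i, hi, hie⟩ := exists_isNth he'o (fun y hy => (mem_sep (P := fun y => y ∊ e').1 hy).2)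
      h'.2 (mem_sep.2 ⟨h.1, hlt⟩)
    rw [isNth_iff] at hie
    have e1 : sep (sep x fun y => y ∊ e') (fun y => y ∊ e) = sep x fun y => y ∊ e := by
      refine ext_of fun z => ?_
      rw [mem_sep, mem_sep, mem_sep]
      exact ⟨fun h => ⟨h.1.1, h.2⟩, fun h => ⟨⟨h.1, he'o.trans h.2 hlt⟩, h.2⟩⟩
    rw [e1] at hie
    have := OrderType.unique (fun y hy => hx y (mem_sep (P := fun y => y ∊ e).1 hy).1) h.2 hie.2
    exact mem_irrefl n (this ▸ hi)
  rcases (hx e h.1).trichotomy (hx e' h'.1) with hlt | rfl | hlt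
  · exact absurd hlt (key e e' h h')
  · rfl
  · exact absurd hlt (key e' e h' h)

/-! ### Injections and Hartogs numbers -/

/-- `f` is an injection from `a` to `b`. -/
def IsInj (f a b : M) : Prop :=
  FunOn f (ext a) ∧ (∀ x, x ∊ a → ap f x ∊ b) ∧
    ∀ x y, x ∊ a → y ∊ a → ap f x = ap f y → x = y

instance : Df fun v : ℕ → M => IsInj (v 0) (v 1) (v 2) := by unfold IsInj; infer_instance

theorem exists_isInj {a b : M} (F : M → M) [DfF fun v : ℕ → M => F (v 0)]
    (h1 : ∀ x, x ∊ a → F x ∊ b) (h2 : ∀ x y, x ∊ a → y ∊ a → F x = F y → x = y) :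
    ∃ f, IsInj f a b := by
  refine ⟨graph F a, funOn_graph fun _ => Iff.rfl, fun x hx => ?_, fun x y hx hy h => ?_⟩
  · rw [ap_graph hx]; exact h1 x hx
  · rw [ap_graph hx, ap_graph hy] at h
    exact h2 x y hx hy h

theorem exists_bij {a b : M} (F : M → M) [DfF fun v : ℕ → M => F (v 0)]
    (h1 : ∀ x, x ∊ a → F x ∊ b) (h2 : ∀ x y, x ∊ a → y ∊ a → F x = F y → x = y)
    (h3 : ∀ y, y ∊ b → ∃ x, x ∊ a ∧ F x = y) : ∃ f, Bij f (ext b) (ext a) := by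
  have spec : ∀ y, y ∊ b → _ := fun y hy => the_spec (P := fun x => x ∊ a ∧ F x = y) (by
    obtain ⟨x, hx, e⟩ := h3 y hy
    exact ⟨x, ⟨hx, e⟩, fun z hz => h2 z x hz.1 hx (hz.2.trans e.symm)⟩)
  refine ⟨graph (fun y => the fun x => x ∊ a ∧ F x = y) b,
    funTo_graph (fun _ => Iff.rfl) fun y hy => (spec y hy).1, fun x hx => ⟨F x, ?_⟩, ?_⟩
  · have := spec _ (h1 x hx)
    exact app_graph.2 ⟨h1 x hx, (h2 _ x this.1 hx this.2).symm⟩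
  · intro y y' x hy hy'
    rw [app_graph] at hy hy'
    rw [← (spec y hy.1).2, ← (spec y' hy'.1).2, ← hy.2, ← hy'.2]

/-- `r` is the linear order on the range of `f` induced by the ordinal `a`. -/
def Codes (r f a : M) : Prop :=
  (∀ p, p ∊ r → ∃ x y, x ∊ a ∧ y ∊ a ∧ p = pr (ap f x) (ap f y)) ∧
    ∀ x y, x ∊ a → y ∊ a → (pr (ap f x) (ap f y) ∊ r ↔ Le x y)

instance : Df fun v : ℕ → M => Codes (v 0) (v 1) (v 2) := by unfold Codes; infer_instance

theorem orderType_self {a : M} (ha : IsOrd a) : OrderType (ext a) a := by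
  refine ⟨ha, graph (fun x => x) a, ⟨funTo_graph (fun _ => Iff.rfl) fun _ h => h, ?_, ?_⟩, ?_⟩
  · exact fun y hy => ⟨y, app_graph.2 ⟨hy, rfl⟩⟩
  · intro x x' y h h'
    rw [← (app_graph.1 h).2, ← (app_graph.1 h').2]
  · intro x y i j h h' hxy
    rwa [(app_graph.1 h).2, (app_graph.1 h').2]

/-- Matching equal values of `f` and `f'` gives an order isomorphism of `a` onto `a'`, and order
types are unique. -/
theorem Codes.unique {r f a f' a' b : M} (ha : IsOrd a) (ha' : IsOrd a') (hf : IsInj f a b)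
    (hf' : IsInj f' a' b) (h : Codes r f a) (h' : Codes r f' a') : a = a' := by
  have half : ∀ f a f' a' : M, Codes r f a → Codes r f' a' → ∀ x, x ∊ a →
      ∃ x', x' ∊ a' ∧ ap f' x' = ap f x := by
    intro f a f' a' h h' x hx
    obtain ⟨x', y', hx', hy', e⟩ := h'.1 _ ((h.2 x x hx hx).2 (Le.refl x))
    exact ⟨x', hx', (pr_inj e).1.symm⟩
  let F : M → M := fun x => the fun x' => x' ∊ a' ∧ ap f' x' = ap f x
  have hF : DfF fun v : ℕ → M => F (v 0) :=
    inferInstanceAs (DfF fun v : ℕ → M => the fun x' => x' ∊ a' ∧ ap f' x' = ap f (v 0))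
  have spec : ∀ x, x ∊ a → F x ∊ a' ∧ ap f' (F x) = ap f x := fun x hx =>
    the_spec (P := fun x' => x' ∊ a' ∧ ap f' x' = ap f x) (by
      obtain ⟨x', hx', e⟩ := half f a f' a' h h' x hx
      exact ⟨x', ⟨hx', e⟩, fun z hz => hf'.2.2 z x' hz.1 hx' (hz.2.trans e.symm)⟩)
  have Finj : ∀ x y, x ∊ a → y ∊ a → F x = F y → x = y := by
    intro x y hx hy e
    exact hf.2.2 x y hx hy (by rw [← (spec x hx).2, ← (spec y hy).2, e])
  refine OrderType.unique (fun y hy => ha.mem hy) (orderType_self ha)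
    ⟨ha', graph F a, ⟨funTo_graph (fun _ => Iff.rfl) fun x hx => (spec x hx).1, ?_, ?_⟩, ?_⟩
  · intro y hy
    obtain ⟨x, hx, e⟩ := half f' a' f a h' h y hy
    refine ⟨x, app_graph.2 ⟨hx, ?_⟩⟩
    exact hf'.2.2 y _ hy (spec x hx).1 (e.symm.trans (spec x hx).2.symm)
  · intro x x' y hx hx'
    rw [app_graph] at hx hx'
    exact Finj x x' hx.1 hx'.1 (hx.2.symm.trans hx'.2)
  · intro x y i j hx hy hxy
    rw [app_graph] at hx hy
    obtain ⟨hx, rfl⟩ := hx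
    obtain ⟨hy, rfl⟩ := hy
    have h1 := (h.2 x y hx hy).2 (Or.inl hxy)
    rw [← (spec x hx).2, ← (spec y hy).2, h'.2 _ _ (spec x hx).1 (spec y hy).1] at h1
    rcases h1 with h1 | h1
    · exact h1
    · exact absurd (Finj x y hx hy h1 ▸ hxy) (mem_irrefl _)

/-- Each such ordinal is decoded from the order it induces on a subset of `b`, so replacement on the
subsets of `b × b` captures them all. The outer `sep` filters out default values at other subsets.
-/
theorem exists_set_of_isInj (b : M) : ∃ m : M, ∀ a, a ∊ m ↔ IsOrd a ∧ ∃ f, IsInj f a b := by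
  refine ⟨sep (img (pow (prod b b)) fun r => the fun a => IsOrd a ∧ ∃ f, IsInj f a b ∧
    Codes r f a) fun a => IsOrd a ∧ ∃ f, IsInj f a b, fun a => ?_⟩
  refine mem_sep.trans ⟨fun h => h.2, fun h => ⟨mem_img.2 ?_, h⟩⟩
  obtain ⟨ha, f, hf⟩ := h
  let r : M := sep (prod b b) fun p =>
    ∃ x y, x ∊ a ∧ y ∊ a ∧ Le x y ∧ p = pr (ap f x) (ap f y)
  have hr : Codes r f a := by
    refine ⟨fun p hp => ?_, fun x y hx hy => ⟨fun hp => ?_, fun hxy => mem_sep.2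
      ⟨mem_prod.2 ⟨hf.2.1 x hx, hf.2.1 y hy⟩, x, y, hx, hy, hxy, rfl⟩⟩⟩
    · obtain ⟨-, x, y, hx, hy, -, e⟩ := mem_sep.1 hp
      exact ⟨x, y, hx, hy, e⟩
    · obtain ⟨-, x', y', hx', hy', hxy, e⟩ := mem_sep.1 hp
      rw [hf.2.2 x x' hx hx' (pr_inj e).1, hf.2.2 y y' hy hy' (pr_inj e).2]
      exact hxy
  refine ⟨r, mem_pow.2 fun p hp => (mem_sep.1 hp).1, ?_⟩
  refine (the_eq ⟨ha, f, hf, hr⟩ ?_).symm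
  rintro a' ⟨ha', f', hf', hr'⟩
  exact hr'.unique ha' ha hf' hf hr

/-- The ordinal `m` is the order type of the range of `f`. The recursion `C` counts the elements of
the range below `i`: stages in the range add one, others contribute `emp`. -/
theorem exists_bij_of_isInj {f n k : M} (hk : IsOrd k) (hf : IsInj f n k) :
    ∃ m g, IsOrd m ∧ Le m k ∧ Bij g (ext m) (ext n) := by
  let N : M → M → M → M := fun _ b y =>
    the fun z => ((∃ x, x ∊ n ∧ ap f x = b) ∧ z = succ y) ∨
      (¬ (∃ x, x ∊ n ∧ ap f x = b) ∧ z = emp)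
  have hN : DfF fun v : ℕ → M => N (v 0) (v 1) (v 2) := inferInstanceAs (DfF fun v : ℕ → M =>
    the fun z => ((∃ x, x ∊ n ∧ ap f x = v 1) ∧ z = succ (v 2)) ∨
      (¬ (∃ x, x ∊ n ∧ ap f x = v 1) ∧ z = emp))
  have N1 : ∀ b y, (∃ x, x ∊ n ∧ ap f x = b) → N emp b y = succ y := fun b y h =>
    the_eq (Or.inl ⟨h, rfl⟩) fun z hz => hz.elim (fun h' => h'.2) fun h' => absurd h h'.1
  have N2 : ∀ b y, (¬ ∃ x, x ∊ n ∧ ap f x = b) → N emp b y = emp := fun b y h =>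
    the_eq (Or.inr ⟨h, rfl⟩) fun z hz => hz.elim (fun h' => absurd h'.1 h) fun h' => h'.2
  let C : M → M := iter N emp
  have hC : DfF fun v : ℕ → M => C (v 0) := inferInstanceAs (DfF fun v : ℕ → M => iter N emp (v 0))
  have memC : ∀ i z, IsOrd i → (z ∊ C i ↔ ∃ x, x ∊ n ∧ ap f x ∊ i ∧ Le z (C (ap f x))) := by
    intro i z hi
    refine (mem_iter hi).trans ⟨?_, ?_⟩
    · rintro ⟨b, hb, hz⟩
      by_cases hbx : ∃ x, x ∊ n ∧ ap f x = b
      · have e : N emp b (iter N emp b) = succ (C b) := N1 _ _ hbx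
        rw [e, mem_succ] at hz
        obtain ⟨x, hx, rfl⟩ := hbx
        exact ⟨x, hx, hb, hz⟩
      · have e : N emp b (iter N emp b) = emp := N2 _ _ hbx
        rw [e] at hz
        exact absurd hz not_mem_emp
    · rintro ⟨x, hx, hxi, hz⟩
      have hbx : ∃ x', x' ∊ n ∧ ap f x' = ap f x := ⟨x, hx, rfl⟩
      have e : N emp (ap f x) (iter N emp (ap f x)) = succ (C (ap f x)) :=
        N1 _ _ hbx
      exact ⟨_, hxi, by rw [e, mem_succ]; exact hz⟩
  have hCo : ∀ i, IsOrd i → IsOrd (C i) ∧ Le (C i) i := by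
    refine IsOrd.induct (fun i => IsOrd (C i) ∧ Le (C i) i) fun i hi ih => ?_
    have h1 : IsOrd (C i) := by
      refine isOrd_iter hi fun b hb => ?_
      by_cases hbx : ∃ x, x ∊ n ∧ ap f x = b
      · have e : N emp b (iter N emp b) = succ (C b) := N1 _ _ hbx
        rw [e]; exact (ih b hb).1.succ
      · have e : N emp b (iter N emp b) = emp := N2 _ _ hbx
        rw [e]; exact isOrd_emp
    refine ⟨h1, (h1.le_iff_sub hi).2 fun z hz => ?_⟩
    obtain ⟨x, hx, hxi, hz⟩ := (memC i z hi).1 hz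
    exact mem_of_le_of_mem hi (hz.trans (hi.mem hxi) (ih _ hxi).2) hxi
  have hfo : ∀ x, x ∊ n → IsOrd (ap f x) := fun x hx => hk.mem (hf.2.1 x hx)
  have hlt : ∀ x y, x ∊ n → y ∊ n → ap f x ∊ ap f y → C (ap f x) ∊ C (ap f y) :=
    fun x y hx hy h => (memC _ _ (hfo y hy)).2 ⟨x, hx, h, Le.refl _⟩
  have hsurj : ∀ i, IsOrd i → ∀ z, z ∊ C i → ∃ x, x ∊ n ∧ C (ap f x) = z := by
    refine IsOrd.induct (fun i => ∀ z, z ∊ C i → ∃ x, x ∊ n ∧ C (ap f x) = z)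
      fun i hi ih z hz => ?_
    obtain ⟨x, hx, hxi, hz | rfl⟩ := (memC i z hi).1 hz
    · exact ih _ hxi z hz
    · exact ⟨x, hx, rfl⟩
  obtain ⟨g, hg⟩ := exists_bij (a := n) (b := C k) (fun x => C (ap f x))
    (fun x hx => (memC _ _ hk).2 ⟨x, hx, hf.2.1 x hx, Le.refl _⟩) (by
      intro x y hx hy e
      rcases (hfo x hx).trichotomy (hfo y hy) with h | h | h
      · exact absurd (e ▸ hlt x y hx hy h) (mem_irrefl _)
      · exact hf.2.2 x y hx hy h
      · exact absurd (e ▸ hlt y x hy hx h) (mem_irrefl _)) (hsurj k hk)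
  exact ⟨C k, g, (hCo k hk).1, (hCo k hk).2, hg⟩

/-- The least cardinal greater than `k` contains all ordinals that inject into `k`. -/
theorem exists_isCardSucc {k : M} (hk : IsOrd k) :
    ∃ m, IsCardSucc k m ∧ ∀ a, IsOrd a → (∃ f, IsInj f a k) → a ∊ m := by
  obtain ⟨m, hm⟩ := exists_set_of_isInj k
  have hmo : IsOrd m := by
    refine ⟨fun a ha z hz => ?_, fun a ha => ((hm a).1 ha).1.1⟩
    obtain ⟨hao, f, hf⟩ := (hm a).1 ha
    exact (hm z).2 ⟨hao.mem hz, exists_isInj (ap f) (fun x hx => hf.2.1 x (hao.trans hx hz))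
      fun x y hx hy => hf.2.2 x y (hao.trans hx hz) (hao.trans hy hz)⟩
  refine ⟨m, ⟨⟨hmo, ?_⟩, ?_, ?_⟩, fun a ha h => (hm a).2 ⟨ha, h⟩⟩
  · rintro n hn ⟨g, ⟨hg, hgm⟩, hsurj, hinj⟩
    obtain ⟨hno, f, hf⟩ := (hm n).1 hn
    have spec : ∀ x, x ∊ m → _ := fun x hx =>
      the_spec (P := fun y => y ∊ n ∧ App g y x) (by
        obtain ⟨y, hy⟩ := hsurj x hx
        exact ⟨y, ⟨hg.mem hy, hy⟩, fun z hz => hinj z y x hz.2 hy⟩)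
    refine mem_irrefl m ((hm m).2 ⟨hmo, exists_isInj
      (fun x => ap f (the fun y => y ∊ n ∧ App g y x)) (fun x hx => hf.2.1 _ (spec x hx).1)
      fun x y hx hy e => ?_⟩)
    have e' := hf.2.2 _ _ (spec x hx).1 (spec y hy).1 e
    have h1 := (spec x hx).2
    rw [e'] at h1
    exact (hg.2 _ (spec y hy).1).unique h1 (spec y hy).2
  · exact (hm k).2 ⟨hk, exists_isInj (fun x => x) (fun _ h => h) fun _ _ _ _ h => h⟩
  · intro n hn hkn
    rw [← hn.1.not_mem hmo]
    intro hnm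
    obtain ⟨hno, f, hf⟩ := (hm n).1 hnm
    obtain ⟨m', g, hm'o, hm'k, hg⟩ := exists_bij_of_isInj hk hf
    -- A cardinal in `m` injects into `k`, so it is equinumerous with an ordinal at most `k`, hence
    -- smaller than itself.
    exact hn.2 m' (mem_of_le_of_mem hno hm'k hkn) ⟨g, hg⟩

/-- An ordinal of uncountable cofinality `k` has a closed unbounded subset indexed by `k`. -/
theorem IsCof.exists_club_indexed {xi k θ : M} (h : IsCof xi k) (hθ : IsLimit θ) (hk : θ ∊ k) :
    ∃ D s : M, Club D xi ∧ ∀ d, d ∊ D → ∃ j, j ∊ k ∧ d = ap s j := by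
  have hl := h.isLimit hθ hk
  obtain ⟨f, ⟨hf, hfx⟩, hfc⟩ := h.2.2.1
  have hfl : ∀ i, i ∊ k → ap f i ∊ xi := fun i hi => hfx _ _ (hf.app hi)
  have hfc' : ∀ x, x ∊ xi → ∃ i, i ∊ k ∧ Le x (ap f i) := by
    intro x hx
    obtain ⟨y, ⟨i, hi⟩, hxy⟩ := hfc.2 x hx
    have hik : i ∊ k := hf.mem hi
    exact ⟨i, hik, (hf.app_iff hik).1 hi ▸ hxy⟩
  have hklim : ∀ i, i ∊ k → succ i ∊ k := by
    intro i hi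
    have hio := h.2.1.mem hi
    rcases (succ_le hio h.2.1).2 hi with hs | hs
    · exact hs
    exfalso
    -- If `k` were `i + 1`, a bound for `f` on `i` together with the single value `f i` would bound
    -- the whole range.
    obtain ⟨x, hx, hb⟩ := h.bound hi (ap f) fun j hj => hfl j (h.2.1.trans hj hi)
    obtain ⟨y, hy, hxy, hyl⟩ := (Club.tail hl (hfl i hi)).exists_gt hl hx
    obtain ⟨j, hj, hyj⟩ := hfc' y hyl
    have hfj := h.1.mem (hfl j hj)
    rw [← hs, mem_succ] at hj
    rcases hj with hj | rfl
    · exact hyj.not_mem ((h.1.mem hyl).trans (hb j hj) hxy)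
    · exact hyj.not_mem (mem_sep.1 hy).2
  -- The running strict supremum of `f`; it is nondecreasing and continuous even if `f` is not, so
  -- its range is a club.
  let S : M → M := fun j => sUnion (img j fun i => succ (ap f i))
  have hS : DfF fun v : ℕ → M => S (v 0) :=
    inferInstanceAs (DfF fun v : ℕ → M => sUnion (img (v 0) fun i => succ (ap f i)))
  have memS : ∀ j z, z ∊ S j ↔ ∃ i, i ∊ j ∧ Le z (ap f i) := by
    intro j z
    refine mem_sUnion.trans ⟨?_, ?_⟩
    · rintro ⟨y, hy, hz⟩
      obtain ⟨i, hi, rfl⟩ := mem_img.1 hy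
      exact ⟨i, hi, mem_succ.1 hz⟩
    · rintro ⟨i, hi, hz⟩
      exact ⟨_, mem_img.2 ⟨i, hi, rfl⟩, mem_succ.2 hz⟩
  have hSo : ∀ j, j ∊ k → IsOrd (S j) := fun j hj => isOrd_sUnion fun y hy => by
    obtain ⟨i, hi, rfl⟩ := mem_img.1 hy
    exact (h.1.mem (hfl i (h.2.1.trans hi hj))).succ
  have hSl : ∀ j, j ∊ k → S j ∊ xi := by
    intro j hj
    obtain ⟨x, hx, hb⟩ := h.bound hj (ap f) fun i hi => hfl i (h.2.1.trans hi hj)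
    refine mem_of_le_of_mem h.1 (((hSo j hj).le_iff_sub (h.1.mem hx)).2 fun z hz => ?_) hx
    obtain ⟨i, hi, hz⟩ := (memS j z).1 hz
    exact mem_of_le_of_mem (h.1.mem hx) hz (hb i hi)
  have hSc : ∀ x, x ∊ xi → ∃ j, j ∊ k ∧ x ∊ S j := by
    intro x hx
    obtain ⟨i, hi, hxi⟩ := hfc' x hx
    exact ⟨_, hklim i hi, (memS _ _).2 ⟨i, mem_succ_self i, hxi⟩⟩
  refine ⟨sep xi fun x => ∃ j, j ∊ k ∧ x = S j, graph S k,
    ⟨⟨fun x hx => (mem_sep.1 hx).1, fun x hx => ?_⟩, fun d hd hdl hdc => ?_⟩, fun d hd => ?_⟩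
  · obtain ⟨j, hj, hxj⟩ := hSc x hx
    exact ⟨S j, mem_sep.2 ⟨hSl j hj, j, hj, rfl⟩, Or.inl hxj⟩
  · obtain ⟨hjo, ⟨hjk, hdj⟩, hmin⟩ := leastOrd_spec (P := fun j => j ∊ k ∧ Le d (S j)) (by
      obtain ⟨j, hj, hdj⟩ := hSc d hd
      exact ⟨j, h.2.1.mem hj, hj, Or.inl hdj⟩)
    generalize leastOrd (fun j => j ∊ k ∧ Le d (S j)) = j at hjo hjk hdj hmin
    refine mem_sep.2 ⟨hd, j, hjk, ?_⟩
    rcases hdj with hdj | hdj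
    swap
    · exact hdj
    -- If `d < S j`, then `d ≤ f i` for some `i < j`, and `S i < d` by minimality of `j`. A member
    -- `S j'` of the range strictly between `S i` and `d` is impossible: `i < j'` gives `f i < S
    -- j'`, and `j' ≤ i` gives `S j' ≤ S i`.
    exfalso
    obtain ⟨i, hi, hdi⟩ := (memS j d).1 hdj
    have hik := h.2.1.trans hi hjk
    have hSi : S i ∊ d := by
      rw [← hdl.1.not_le (hSo i hik)]
      exact fun h' => hmin i hi ⟨hik, h'⟩
    obtain ⟨y, ⟨hy, hyd⟩, hiy⟩ := hdc.2 _ (hdl.succ_mem hSi)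
    obtain ⟨-, j', hj', rfl⟩ := mem_sep.1 hy
    have hiy' : S i ∊ S j' := (succ_le (hSo i hik) (hSo j' hj')).1 hiy
    by_cases hij : i ∊ j'
    · exact hdi.not_mem (hdl.1.trans ((memS _ _).2 ⟨i, hij, Le.refl _⟩) hyd)
    · have hj'i := ((h.2.1.mem hik).not_mem (h.2.1.mem hj')).1 hij
      obtain ⟨l, hl', hle⟩ := (memS _ _).1 hiy'
      exact mem_irrefl _ ((memS _ _).2 ⟨l, mem_of_mem_of_le (h.2.1.mem hik) hl' hj'i, hle⟩)
  · obtain ⟨-, j, hj, rfl⟩ := mem_sep.1 hd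
    exact ⟨j, hj, (ap_graph hj).symm⟩

end Hartogs

section Greedy

variable {M : Type*} [setLang.Structure M] [hM : ZFModel M]

/-! ### The least sequence of successive stationary intervals -/

/-- Taking least ordinals here and in the next definitions makes everything uniformly definable in
`xi`, so the functions of the second part exist by replacement. -/
noncomputable def statIdx (R : M → M → Prop) (xi : M) : M :=
  leastOrd fun n => ∀ a, a ∊ xi → ∃ b, a ∊ b ∧ b ∊ xi ∧ StatIn R n a b xi

noncomputable def statNext (R : M → M → Prop) (xi x : M) : M :=
  leastOrd fun b => x ∊ b ∧ StatIn R (statIdx R xi) x b xi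

noncomputable def statSeq (R : M → M → Prop) (xi a : M) : M :=
  iter (fun p _ x => statNext R p x) xi a

noncomputable def statLen (R : M → M → Prop) (xi : M) : M :=
  leastOrd fun b => ¬ statSeq R xi b ∊ xi

variable {R : M → M → Prop} [hR : Df fun v : ℕ → M => R (v 0) (v 1)]

instance : DfF fun v : ℕ → M => statIdx R (v 0) := by unfold statIdx; infer_instance
instance : DfF fun v : ℕ → M => statNext R (v 0) (v 1) := by unfold statNext; infer_instance
instance statNext_df : DfF fun v : ℕ → M => (fun p _ x => statNext R p x) (v 0) (v 1) (v 2) :=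
  inferInstanceAs (DfF fun v : ℕ → M => statNext R (v 0) (v 2))
instance : DfF fun v : ℕ → M => statSeq R (v 0) (v 1) := by unfold statSeq; infer_instance
instance : DfF fun v : ℕ → M => statLen R (v 0) := by unfold statLen; infer_instance

theorem mem_statSeq {xi a z : M} (ha : IsOrd a) :
    z ∊ statSeq R xi a ↔ ∃ b, b ∊ a ∧ z ∊ statNext R xi (statSeq R xi b) := by
  have := statNext_df (R := R)
  exact mem_iter (N := fun p _ x => statNext R p x) ha

theorem isOrd_statSeq {xi a : M} (ha : IsOrd a)
    (h : ∀ b, b ∊ a → IsOrd (statNext R xi (statSeq R xi b))) : IsOrd (statSeq R xi a) := by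
  have := statNext_df (R := R)
  exact isOrd_iter (N := fun p _ x => statNext R p x) ha h

variable {xi : M} (hxi : IsLimit xi)
  (hstat : ∃ n, IsOrd n ∧ ∀ a, a ∊ xi → ∃ b, a ∊ b ∧ b ∊ xi ∧ StatIn R n a b xi)

include hxi hstat

theorem statNext_spec {x : M} (hx : x ∊ xi) : x ∊ statNext R xi x ∧ statNext R xi x ∊ xi ∧
    StatIn R (statIdx R xi) x (statNext R xi x) xi := by
  have h1 := (leastOrd_spec
    (P := fun n => ∀ a, a ∊ xi → ∃ b, a ∊ b ∧ b ∊ xi ∧ StatIn R n a b xi) hstat).2.1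
  obtain ⟨b, hb, hbx, hS⟩ := h1 x hx
  have hbo := hxi.1.mem hbx
  have h2 := leastOrd_spec (P := fun b => x ∊ b ∧ StatIn R (statIdx R xi) x b xi)
    ⟨b, hbo, hb, hS⟩
  have h3 := leastOrd_le (P := fun b => x ∊ b ∧ StatIn R (statIdx R xi) x b xi) hbo ⟨hb, hS⟩
  exact ⟨h2.2.1.1, mem_of_le_of_mem hxi.1 h3 hbx, h2.2.1.2⟩

theorem statSeq_lt {i j : M} (hj : IsOrd j) (hij : i ∊ j) (hi : statSeq R xi i ∊ xi) :
    statSeq R xi i ∊ statSeq R xi j :=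
  (mem_statSeq hj).2 ⟨i, hij, (statNext_spec hxi hstat hi).1⟩

/-- A strictly increasing sequence of ordinals satisfies `b ≤ statSeq R xi b`, so it must leave `xi`
at some stage at most `xi`. -/
theorem statLen_spec : IsOrd (statLen R xi) ∧ Le (statLen R xi) xi ∧
    ¬ statSeq R xi (statLen R xi) ∊ xi ∧ ∀ b, b ∊ statLen R xi → statSeq R xi b ∊ xi := by
  have h : ∃ b, IsOrd b ∧ Le b xi ∧ ¬ statSeq R xi b ∊ xi := by
    by_contra H
    push Not at H
    have key : ∀ b, IsOrd b → Le b xi → Le b (statSeq R xi b) := by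
      refine IsOrd.induct (fun b => Le b xi → Le b (statSeq R xi b)) fun b hb ih hbx => ?_
      have hsb := hxi.1.mem (H b hb hbx)
      refine (hb.le_iff_sub hsb).2 fun i hi => ?_
      have hix : i ∊ xi := mem_of_mem_of_le hxi.1 hi hbx
      exact mem_of_le_of_mem hsb (ih i hi (Or.inl hix))
        (statSeq_lt hxi hstat hb hi (H i (hb.mem hi) (Or.inl hix)))
    exact (key xi hxi.1 (Le.refl xi)).not_mem (H xi hxi.1 (Le.refl xi))
  obtain ⟨b, hb, hbx, hs⟩ := h
  have h1 := leastOrd_spec (P := fun b => ¬ statSeq R xi b ∊ xi) ⟨b, hb, hs⟩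
  have h2 := leastOrd_le (P := fun b => ¬ statSeq R xi b ∊ xi) hb hs
  exact ⟨h1.1, h2.trans hxi.1 hbx, h1.2.1, fun b hb => not_not.1 (h1.2.2 b hb)⟩

theorem statSeq_succ {i : M} (hi : IsOrd i) (h : ∀ j, j ∊ succ i → statSeq R xi j ∊ xi) :
    statSeq R xi (succ i) = statNext R xi (statSeq R xi i) := by
  have hs := statNext_spec hxi hstat (h i (mem_succ_self i))
  refine ext_of fun z => (mem_statSeq hi.succ).trans ⟨?_, fun hz => ⟨i, mem_succ_self i, hz⟩⟩
  rintro ⟨b, hb, hz⟩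
  -- Contributions from stages before `i` lie in the `i`-th term, hence below the next one, so only
  -- stage `i` matters.
  rcases mem_succ.1 hb with hb | rfl
  · exact (hxi.1.mem hs.2.1).trans ((mem_statSeq hi).2 ⟨b, hb, hz⟩) hs.1
  · exact hz

theorem succ_mem_statLen {i : M} (hi : i ∊ statLen R xi) : succ i ∊ statLen R xi := by
  obtain ⟨hlo, -, hn, hlt⟩ := statLen_spec hxi hstat
  have hio := hlo.mem hi
  rcases (succ_le hio hlo).2 hi with h | h
  · exact h
  · rw [← h] at hn hlt
    refine absurd ?_ hn
    rw [statSeq_succ hxi hstat hio hlt]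
    exact (statNext_spec hxi hstat (hlt i (mem_succ_self i))).2.1

theorem statSeq_succ_of_mem {i : M} (hi : i ∊ statLen R xi) :
    statSeq R xi (succ i) = statNext R xi (statSeq R xi i) := by
  obtain ⟨hlo, -, hn, hlt⟩ := statLen_spec hxi hstat
  exact statSeq_succ hxi hstat (hlo.mem hi) fun j hj =>
    hlt j (hlo.trans hj (succ_mem_statLen hxi hstat hi))

theorem statIn_statSeq {i : M} (hi : i ∊ statLen R xi) :
    StatIn R (statIdx R xi) (statSeq R xi i) (statSeq R xi (succ i)) xi := by
  rw [statSeq_succ_of_mem hxi hstat hi]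
  exact (statNext_spec hxi hstat ((statLen_spec hxi hstat).2.2.2 i hi)).2.2

theorem contIncCofinal_statSeq :
    ContIncCofinal (graph (statSeq R xi) (statLen R xi)) (statLen R xi) xi := by
  obtain ⟨hlo, -, hn, hlt⟩ := statLen_spec hxi hstat
  have hseq : ∀ j, j ∊ statLen R xi → ∀ z, z ∊ statSeq R xi j ↔
      ∃ i, i ∊ j ∧ z ∊ statSeq R xi (succ i) := by
    intro j hj z
    refine (mem_statSeq (hlo.mem hj)).trans (exists_congr fun i => and_congr_right fun hi => ?_)
    rw [statSeq_succ_of_mem hxi hstat (hlo.trans hi hj)]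
  refine ⟨funTo_graph (fun _ => Iff.rfl) hlt, ?_, ?_, ?_, ?_⟩
  · intro i j a b ha hb hij
    obtain ⟨hi, rfl⟩ := app_graph.1 ha
    obtain ⟨hj, rfl⟩ := app_graph.1 hb
    exact statSeq_lt hxi hstat (hlo.mem hj) hij (hlt i hi)
  · intro i a hil ha x
    obtain ⟨hi, rfl⟩ := app_graph.1 ha
    rw [hseq i hi]
    constructor
    · rintro ⟨j, hj, hx⟩
      have hsj := hil.succ_mem hj
      exact ⟨succ j, _, hsj, app_graph.2 ⟨hlo.trans hsj hi, rfl⟩, hx⟩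
    · rintro ⟨j, b, hj, hb, hx⟩
      obtain ⟨hjl, rfl⟩ := app_graph.1 hb
      have hsj := succ_mem_statLen hxi hstat hjl
      exact ⟨j, hj, (hxi.1.mem (hlt _ hsj)).trans hx
        (statSeq_lt hxi hstat (hlo.mem hsj) (mem_succ_self j) (hlt j hjl))⟩
  · rintro a ⟨i, ha⟩
    obtain ⟨hi, rfl⟩ := app_graph.1 ha
    exact hlt i hi
  · intro x hx
    have hso : IsOrd (statSeq R xi (statLen R xi)) := isOrd_statSeq hlo fun b hb =>
      hxi.1.mem (statNext_spec hxi hstat (hlt b hb)).2.1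
    -- The term at the terminal stage is an ordinal outside `xi`, so it includes `xi`; being a
    -- supremum of earlier steps, it makes the sequence cofinal.
    have hx' : x ∊ statSeq R xi (statLen R xi) :=
      mem_of_mem_of_le hso hx ((hso.not_mem hxi.1).1 hn)
    obtain ⟨b, hb, hxb⟩ := (mem_statSeq hlo).1 hx'
    rw [← statSeq_succ_of_mem hxi hstat hb] at hxb
    exact ⟨_, ⟨succ b, app_graph.2 ⟨succ_mem_statLen hxi hstat hb, rfl⟩⟩, Or.inl hxb⟩

/-- Each interval gives a stationary set meeting `D`; it is sent to the least index of a point of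
`D` in that set. This is injective because the `n`-th member of a ladder is unique and the intervals
are disjoint. -/
theorem exists_isInj_statLen {k D s : M} (hk : IsOrd k) (hD : Club D xi)
    (hDs : ∀ d, d ∊ D → ∃ j, j ∊ k ∧ d = ap s j)
    (hfun : ∀ d x x', R d x → R d x' → x = x')
    (hord : ∀ d x y, R d x → y ∊ x → IsOrd y) : ∃ f, IsInj f (statLen R xi) k := by
  obtain ⟨hlo, -, hn, hlt⟩ := statLen_spec hxi hstat
  have spec : ∀ i, i ∊ statLen R xi → _ := fun i hi =>
    leastOrd_spec (P := fun j => j ∊ k ∧ InLadderS R (statIdx R xi) (statSeq R xi i)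
      (statSeq R xi (succ i)) (ap s j)) (by
      obtain ⟨d, hd, -, hS⟩ := statIn_statSeq hxi hstat hi D hD
      obtain ⟨j, hj, rfl⟩ := hDs d hd
      exact ⟨j, hk.mem hj, hj, hS⟩)
  refine exists_isInj (fun i => leastOrd fun j => j ∊ k ∧ InLadderS R (statIdx R xi)
    (statSeq R xi i) (statSeq R xi (succ i)) (ap s j)) (fun i hi => (spec i hi).2.1.1) ?_
  have disj : ∀ i j d, i ∊ j → j ∊ statLen R xi →
      InLadderS R (statIdx R xi) (statSeq R xi i) (statSeq R xi (succ i)) d →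
      ¬ InLadderS R (statIdx R xi) (statSeq R xi j) (statSeq R xi (succ j)) d := by
    rintro i j d hij hj ⟨x, hx, -, e, he, -, hei⟩ ⟨x', hx', -, e', he', hje, -⟩
    obtain rfl := hfun d x x' hx hx'
    obtain rfl := he.unique (fun y hy => hord d x y hx hy) he'
    have hjx := hxi.1.mem (hlt j hj)
    have hjo := hlo.mem hj
    have hsi : Le (statSeq R xi (succ i)) (statSeq R xi j) := by
      rcases (succ_le (hjo.mem hij) hjo).2 hij with h | h
      · exact Or.inl (statSeq_lt hxi hstat hjo h (hlt _ (hlo.trans h hj)))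
      · exact Or.inr (by rw [h])
    exact hje.not_mem (mem_of_mem_of_le hjx hei hsi)
  intro i j hi hj e
  have h1 := (spec i hi).2.1.2
  have h2 := (spec j hj).2.1.2
  rw [e] at h1
  rcases (hlo.mem hi).trichotomy (hlo.mem hj) with h | h | h
  · exact absurd h2 (disj i j _ h hj h1)
  · exact h
  · exact absurd h1 (disj j i _ h hi h2)

end Greedy

/-! ### Transfer to the given ladder system and assembly of the theorem. -/

section

variable {M : Type*} [setLang.Structure M] [hM : ZFModel M]

theorem stationary_ladderS_of_statIn {R : M → M → Prop} {n a b lam : M}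
    (hR : ∀ d x, R d x → d ∊ lam) (h : StatIn R n a b lam) :
    Stationary (LadderS R n a b) lam :=
  ⟨fun d ⟨x, hx, _⟩ => hR d x hx, fun D hD =>
    let ⟨d, hd, _, hS⟩ := h D hD
    ⟨d, hd, hS⟩⟩

theorem stationary_ladderS_restrictTo {R : M → M → Prop} {n a b xi : M}
    (h : StatIn R n a b xi) : Stationary (LadderS (restrictTo R xi) n a b) xi :=
  ⟨fun _ ⟨_, hx, _⟩ => hx.2, fun D hD =>
    let ⟨d, hd, hdx, x, hx, hS⟩ := h D hD
    ⟨d, hd, x, ⟨hx, hdx⟩, hS⟩⟩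

theorem Club.sep_of_cofinal {E lam xi : M} (hlam : IsOrd lam) (hE : Club E lam) (hxi : xi ∊ lam)
    (h : Cofinal (ext E ∩ ext xi) xi) : Club (sep xi fun x => x ∊ E) xi := by
  refine ⟨⟨fun x hx => (mem_sep.1 hx).1, fun x hx => ?_⟩, fun d hd hdl hdc => mem_sep.2 ⟨hd, ?_⟩⟩
  · obtain ⟨y, ⟨hy, hyx⟩, hxy⟩ := h.2 x hx
    exact ⟨y, mem_sep.2 ⟨hyx, hy⟩, hxy⟩
  · refine hE.mem_of_forall (hlam.trans hd hxi) hdl fun x hx => ?_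
    obtain ⟨y, ⟨hy, hyd⟩, hxy⟩ := hdc.2 x hx
    exact ⟨y, (mem_sep.1 hy).2, hxy, hyd⟩

theorem exists_set_highCofPoints (lam γ E : M) :
    ∃ C : M, ∀ x, x ∈ HighCofPoints lam γ E ↔ x ∊ C := by
  refine ⟨sep lam fun x => (∃ k, IsCof x k ∧ γ ∊ k ∧ k ∊ lam) ∧
    (∀ y, y ∊ E ∧ y ∊ x → y ∊ x) ∧ ∀ y, y ∊ x → ∃ z, (z ∊ E ∧ z ∊ x) ∧ Le y z, fun x => ?_⟩
  rw [mem_sep]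
  exact Iff.rfl

end

end ZFM

open ZFM in
theorem theorem3p1 {M : Type*} [setLang.Structure M] (hM : ModelsZF M)
    (θ γ lam E c : M)
    (hθ : IsInfRegular θ) (hDC : DC θ)
    (hγ : IsOrd γ) (hθγ : Le θ γ) (hAC : AC γ)
    (hlam : IsOrd lam) (hcof : ∃ k : M, IsCof lam k ∧ γ ∊ k)
    (hE : Club E lam) (hc : IsLadderSystem c lam θ γ E) :
    (∃ n : M, n ∊ γ ∧ ∀ a : M, a ∊ lam → ∃ b : M, a ∊ b ∧ b ∊ lam ∧
      Stationary (LadderS (App c) n a b) lam) ∧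
    (∃ g h A : M,
      FunTo g (HighCofPoints lam γ E) (ext γ) ∧
      FunTo h (HighCofPoints lam γ E) (ext lam) ∧
      FunOn A (HighCofPoints lam γ E) ∧
      ∀ xi ∈ HighCofPoints lam γ E, ∃ n l s : M,
        App g xi n ∧ App h xi l ∧ App A xi s ∧
        (∃ k m : M, IsCof xi k ∧ IsCardSucc k m ∧ l ∊ m) ∧
        ContIncCofinal s l xi ∧
        ∀ i : M, i ∊ l → ∃ i' a a' : M, IsSucc i i' ∧ App s i a ∧ App s i' a' ∧
          Stationary (LadderS (restrictTo (App c) xi) n a a') xi) := by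
  have : ZFModel M := ⟨hM⟩
  obtain ⟨hcF, hcL⟩ := hc
  have hladder : ∀ d, d ∊ lam → IsCof d θ → d ∊ E →
      ∃ x, App c d x ∧ Cofinal (ext x) d ∧ ∃ r, OrderType (ext x) r ∧ Le r γ := by
    intro d hd hdθ hdE
    have happ := hcF.app (show d ∈ LadderDomain lam θ E from ⟨hd, hdθ, hdE⟩)
    exact ⟨_, happ, hcL _ _ happ⟩
  have hfun : ∀ d x x', App c d x → App c d x' → x = x' := fun d x x' h h' =>
    (hcF.2 d (hcF.mem h)).unique h h'
  have hord : ∀ d x y, App c d x → y ∊ x → IsOrd y := fun d x y h hy =>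
    (hlam.mem (hcF.mem h).1).mem ((hcL d x h).1.1 hy)
  refine ⟨?_, ?_⟩
  · obtain ⟨k, hk, hγk⟩ := hcof
    obtain ⟨n, hn, H⟩ := exists_statIn (R := App c) hθ hDC hγ hθγ hAC hk hγk hE hladder
    refine ⟨n, hn, fun a ha => ?_⟩
    obtain ⟨b, hab, hb, hS⟩ := H a ha
    exact ⟨b, hab, hb, stationary_ladderS_of_statIn (fun d x h => (hcF.mem h).1) hS⟩
  · obtain ⟨C, hC⟩ := exists_set_highCofPoints lam γ E
    have hstat : ∀ xi, xi ∊ C → IsLimit xi ∧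
        ∃ n, n ∊ γ ∧ ∀ a, a ∊ xi → ∃ b, a ∊ b ∧ b ∊ xi ∧ StatIn (App c) n a b xi := by
      intro xi hxi
      obtain ⟨hxil, ⟨k, hk, hγk, -⟩, hEc⟩ := (hC xi).2 hxi
      refine ⟨hk.isLimit hθ.1 (mem_of_le_of_mem hk.2.1 hθγ hγk), ?_⟩
      -- At `xi` the club is `E ∩ xi`, and the ladders are those of `c` at points below `xi`.
      exact exists_statIn hθ hDC hγ hθγ hAC hk hγk (hE.sep_of_cofinal hlam hxil hEc)
        fun d hd hdθ hdE => hladder d (hlam.trans hd hxil) hdθ (mem_sep.1 hdE).2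
    have hstat' : ∀ xi, xi ∊ C → ∃ n, IsOrd n ∧
        ∀ a, a ∊ xi → ∃ b, a ∊ b ∧ b ∊ xi ∧ StatIn (App c) n a b xi := by
      intro xi hxi
      obtain ⟨-, n, hn, H⟩ := hstat xi hxi
      exact ⟨n, hγ.mem hn, H⟩
    refine ⟨graph (statIdx (App c)) C, graph (statLen (App c)) C,
      graph (fun xi => graph (statSeq (App c) xi) (statLen (App c) xi)) C,
      funTo_graph hC fun xi hxi => ?_, funTo_graph hC fun xi hxi => ?_, funOn_graph hC,
      fun xi hxi => ?_⟩
    · obtain ⟨-, n, hn, H⟩ := hstat xi hxi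
      -- The least good index is at most the good index `n` below γ.
      exact mem_of_le_of_mem hγ (leastOrd_le
        (P := fun n => ∀ a, a ∊ xi → ∃ b, a ∊ b ∧ b ∊ xi ∧ StatIn (App c) n a b xi)
        (hγ.mem hn) H) hn
    · exact mem_of_le_of_mem hlam (statLen_spec (hstat xi hxi).1 (hstat' xi hxi)).2.1
        ((hC xi).2 hxi).1
    · have hxiC := (hC xi).1 hxi
      have hl := (hstat xi hxiC).1
      have hs := hstat' xi hxiC
      obtain ⟨hxil, ⟨k, hk, hγk, -⟩, hEc⟩ := hxi
      refine ⟨_, _, _, app_graph.2 ⟨hxiC, rfl⟩, app_graph.2 ⟨hxiC, rfl⟩,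
        app_graph.2 ⟨hxiC, rfl⟩, ?_, contIncCofinal_statSeq hl hs, fun i hi => ?_⟩
      · obtain ⟨m, hm, hmi⟩ := exists_isCardSucc hk.2.1
        obtain ⟨D, s, hD, hDs⟩ := hk.exists_club_indexed hθ.1
          (mem_of_le_of_mem hk.2.1 hθγ hγk)
        exact ⟨k, m, hk, hm, hmi _ (statLen_spec hl hs).1
          (exists_isInj_statLen hl hs hk.2.1 hD hDs hfun hord)⟩
      · exact ⟨succ i, _, _, isSucc_iff.2 rfl, app_graph.2 ⟨hi, rfl⟩,
          app_graph.2 ⟨succ_mem_statLen hl hs hi, rfl⟩,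
          stationary_ladderS_restrictTo (statIn_statSeq hl hs hi)⟩
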